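/- Let $D$ be a finite set and let $\Gamma$ be a finite set of relations over $D$, each a subset of $D^k$ for some integer $k\ge 1$. Suppose that the dual discriminator $d\colon D^3\to D$, where $d(x_1,x_2,x_3)$ is the value that occurs at least twice among $x_1,x_2,x_3$ if there is one and $d(x_1,x_2,x_3)=x_1$ otherwise, is a polymorphism of $\Gamma$: applied coordinatewise to any three tuples of a relation $R\in\Gamma$, it gives a tuple of $R$. An instance of $\mathrm{MinCostCSP}(\Gamma)$ consists of a finite set $V$ of variables, a finite set of constraints, each given by a $k$-ary relation $R\in\Gamma$ and a tuple $(v_1,\dots,v_k)\in V^k$, and a cost $\mathrm{cost}(v,a)\in\mathbb{Q}_{\ge 0}\cup\{+\infty\}$, written in binary, for all $v\in V$ and $a\in D$. An assignment $A\colon V\to D$ is satisfying if $(A(v_1),\dots,A(v_k))\in R$ for every constraint, and its cost is $\sum_{v\in V}\mathrm{cost}(v,A(v))$. Then $\mathrm{MinCostCSP}(\Gamma)$ can be $|D|$-approximated in polynomial time: there is an algorithm that, on every instance, runs in time polynomial in the size of the instance, returns a satisfying assignment whose cost is at most $|D|$ times the minimum cost of a satisfying assignment if the instance is satisfiable, and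 reports that the instance is unsatisfiable otherwise. The algorithm and the polynomial may depend on $D$ and $\Gamma$. -/

import Mathlib

namespace CSP

/-! ## A machine model with a cost measure

Programs of a WHILE language over binary trees.  Every construct that is executed on a tree `x` is
charged `1 + size x` steps, in addition to the steps of its subprograms.  In particular no
elementary operation is cheaper than reading (or copying, or comparing) its whole argument, so
that a multitape Turing machine simulates the programs with polynomial overhead, and conversely;
"polynomially many steps" has its usual meaning. -/

/-- Binary trees, the data that programs work on. -/
inductive Data : Type
  | nil : Data
  | cons : Data → Data → Data

namespace Data

/-- Number of nodes of a tree (leaves included). -/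
def size : Data → ℕ
  | nil => 1
  | cons a b => a.size + b.size + 1

/-- Left subtree. -/
def hd : Data → Data
  | nil => nil
  | cons a _ => a

/-- Right subtree. -/
def tl : Data → Data
  | nil => nil
  | cons _ b => b

end Data

/-- Programs; each one takes one tree as input and returns one tree if it halts. -/
inductive Prog : Type
  /-- return the input -/
  | ident : Prog
  /-- return the leaf -/
  | nil : Prog
  /-- return the left subtree -/
  | hd : Prog
  /-- return the right subtree -/
  | tl : Prog
  /-- test whether the two subtrees of the input are equal -/
  | eq : Prog
  /-- run both programs on the input and join the two results to a tree -/
  | cons : Prog → Prog → Prog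
  /-- `seq p q`: run `p`, then run `q` on the result -/
  | seq : Prog → Prog → Prog
  /-- `ite c p q`: run `p` if `c` returns a tree other than the leaf, and `q` otherwise -/
  | ite : Prog → Prog → Prog → Prog
  /-- `loop c p`: as long as `c` returns a tree other than the leaf, replace the current tree by
  the result of `p` -/
  | loop : Prog → Prog → Prog

/-- `Runs p x y t`: on input `x` the program `p` halts with output `y` after `t` steps. -/
inductive Runs : Prog → Data → Data → ℕ → Prop
  | ident (x : Data) : Runs .ident x x (1 + x.size)
  | nil (x : Data) : Runs .nil x .nil (1 + x.size)
  | hd (x : Data) : Runs .hd x x.hd (1 + x.size)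
  | tl (x : Data) : Runs .tl x x.tl (1 + x.size)
  | eq_true (x : Data) (h : x.hd = x.tl) : Runs .eq x (.cons .nil .nil) (1 + x.size)
  | eq_false (x : Data) (h : x.hd ≠ x.tl) : Runs .eq x .nil (1 + x.size)
  | cons {p q : Prog} {x a b : Data} {s t : ℕ} (hp : Runs p x a s) (hq : Runs q x b t) :
      Runs (.cons p q) x (.cons a b) (1 + x.size + s + t)
  | seq {p q : Prog} {x y z : Data} {s t : ℕ} (hp : Runs p x y s) (hq : Runs q y z t) :
      Runs (.seq p q) x z (1 + x.size + s + t)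
  | ite_true {c p q : Prog} {x a b y : Data} {s t : ℕ}
      (hc : Runs c x (.cons a b) s) (hp : Runs p x y t) :
      Runs (.ite c p q) x y (1 + x.size + s + t)
  | ite_false {c p q : Prog} {x y : Data} {s t : ℕ}
      (hc : Runs c x .nil s) (hq : Runs q x y t) :
      Runs (.ite c p q) x y (1 + x.size + s + t)
  | loop_stop {c p : Prog} {x : Data} {s : ℕ} (hc : Runs c x .nil s) :
      Runs (.loop c p) x x (1 + x.size + s)
  | loop_step {c p : Prog} {x a b y z : Data} {s t u : ℕ}
      (hc : Runs c x (.cons a b) s) (hp : Runs p x y t) (hl : Runs (.loop c p) y z u) :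
      Runs (.loop c p) x z (1 + x.size + s + t + u)

/-- Programs are deterministic: output and number of steps are determined by the input. -/
theorem Runs.deterministic {p : Prog} {x y y' : Data} {t t' : ℕ}
    (h : Runs p x y t) (h' : Runs p x y' t') : y = y' ∧ t = t' := by
  induction h generalizing y' t' with
  | ident | nil | hd | tl => cases h'; exact ⟨rfl, rfl⟩
  | eq_true x h => cases h' with
    | eq_true => exact ⟨rfl, rfl⟩
    | eq_false _ h2 => exact absurd h h2
  | eq_false x h => cases h' with
    | eq_true _ h2 => exact absurd h2 h
    | eq_false => exact ⟨rfl, rfl⟩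
  | cons _ _ ih1 ih2 => cases h' with
    | cons k1 k2 =>
      obtain ⟨rfl, rfl⟩ := ih1 k1
      obtain ⟨rfl, rfl⟩ := ih2 k2
      exact ⟨rfl, rfl⟩
  | seq _ _ ih1 ih2 => cases h' with
    | seq k1 k2 =>
      obtain ⟨rfl, rfl⟩ := ih1 k1
      obtain ⟨rfl, rfl⟩ := ih2 k2
      exact ⟨rfl, rfl⟩
  | ite_true _ _ ih1 ih2 => cases h' with
    | ite_true k1 k2 =>
      obtain ⟨_, rfl⟩ := ih1 k1
      obtain ⟨rfl, rfl⟩ := ih2 k2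
      exact ⟨rfl, rfl⟩
    | ite_false k1 _ => cases (ih1 k1).1
  | ite_false _ _ ih1 ih2 => cases h' with
    | ite_true k1 _ => cases (ih1 k1).1
    | ite_false k1 k2 =>
      obtain ⟨_, rfl⟩ := ih1 k1
      obtain ⟨rfl, rfl⟩ := ih2 k2
      exact ⟨rfl, rfl⟩
  | loop_stop _ ih => cases h' with
    | loop_stop k => exact ⟨rfl, by rw [(ih k).2]⟩
    | loop_step k _ _ => cases (ih k).1
  | loop_step _ _ _ ih1 ih2 ih3 => cases h' with
    | loop_stop k => cases (ih1 k).1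
    | loop_step k1 k2 k3 =>
      obtain ⟨_, rfl⟩ := ih1 k1
      obtain ⟨rfl, rfl⟩ := ih2 k2
      obtain ⟨rfl, rfl⟩ := ih3 k3
      exact ⟨rfl, rfl⟩

/-! ### Encodings -/

/-- A list of trees as one tree. -/
def encodeList : List Data → Data
  | [] => .nil
  | a :: l => .cons a (encodeList l)

/-- A bit. -/
def encodeBool : Bool → Data
  | false => .nil
  | true => .cons .nil .nil

/-- A natural number in binary, least significant bit first. -/
def encodeNat (n : ℕ) : Data :=
  encodeList (n.bits.map encodeBool)

/-- A cost: `+∞` is the leaf, a rational number is the pair of its numerator and its denominator,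
in binary. -/
def encodeCost : WithTop ℚ≥0 → Data
  | none => .nil
  | some q => .cons (encodeNat q.num) (encodeNat q.den)

/-! ## Relations, polymorphisms, `MinCostCSP` -/

variable {D : Type*}

/-- A relation over `D`: a subset of `D ^ arity`, where `arity` is positive. -/
structure Relation (D : Type*) where
  arity : ℕ
  arity_pos : 0 < arity
  tuples : Set (Fin arity → D)

/-- The operation `f : D ^ k → D` preserves the relation `R`. -/
def Relation.PreservedBy (R : Relation D) {k : ℕ} (f : (Fin k → D) → D) : Prop :=
  ∀ a : Fin k → Fin R.arity → D, (∀ i, a i ∈ R.tuples) →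
    (fun j => f (fun i => a i j)) ∈ R.tuples

/-- `f` is a polymorphism of the constraint language `Γ` (a finite set of relations over `D`). -/
def IsPolymorphism (Γ : Finset (Relation D)) {k : ℕ} (f : (Fin k → D) → D) : Prop :=
  ∀ R ∈ Γ, R.PreservedBy f

open Classical in
/-- The dual discriminator: the value that occurs at least twice among the three arguments if there
is one, and the first argument otherwise. -/
noncomputable def dualDiscriminator (D : Type*) (x : Fin 3 → D) : D :=
  if x 0 = x 1 ∨ x 0 = x 2 then x 0
  else if x 1 = x 2 then x 1
  else x 0

/-- A constraint on the variables `0, …, n - 1`: a relation of `Γ` and a tuple of variables. -/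
structure Constraint (Γ : Finset (Relation D)) (n : ℕ) where
  rel : {R // R ∈ Γ}
  scope : Fin rel.1.arity → Fin n

/-- An instance of `MinCostCSP(Γ)`; its variables are `0, …, numVars - 1`. -/
structure Instance (Γ : Finset (Relation D)) where
  numVars : ℕ
  constraints : List (Constraint Γ numVars)
  cost : Fin numVars → D → WithTop ℚ≥0

namespace Instance

variable {Γ : Finset (Relation D)}

/-- The assignment `A` satisfies every constraint. -/
def Satisfies (I : Instance Γ) (A : Fin I.numVars → D) : Prop :=
  ∀ C ∈ I.constraints, (fun j => A (C.scope j)) ∈ C.rel.1.tuples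

/-- The total cost of an assignment. -/
def totalCost (I : Instance Γ) (A : Fin I.numVars → D) : WithTop ℚ≥0 :=
  ∑ v, I.cost v (A v)

open Classical in
/-- The minimum cost of a satisfying assignment (`+∞` if there is none). -/
noncomputable def opt [Fintype D] (I : Instance Γ) : WithTop ℚ≥0 :=
  (Finset.univ.filter fun A : Fin I.numVars → D => I.Satisfies A).inf I.totalCost

/-- A correct answer of an `r`-approximation algorithm on `I`: either a satisfying assignment whose
cost is at most `r` times the optimum, or the answer `none` on an unsatisfiable instance. -/
def IsApproxAnswer [Fintype D] (I : Instance Γ) (r : ℕ) : Option (Fin I.numVars → D) → Prop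
  | some A => I.Satisfies A ∧ I.totalCost A ≤ r • I.opt
  | none => ∀ A, ¬ I.Satisfies A

/-- An instance as a tree: the list of the constraints, each given by the number of its relation
and the list of its variables, and the table of the costs, with one row for each variable. -/
def encode [Fintype D] (I : Instance Γ)
    (numD : D ≃ Fin (Fintype.card D)) (numΓ : {R // R ∈ Γ} ≃ Fin Γ.card) : Data :=
  .cons
    (encodeList (I.constraints.map fun C =>
      .cons (encodeNat (numΓ C.rel)) (encodeList (List.ofFn fun j => encodeNat (C.scope j)))))
    (encodeList (List.ofFn fun v =>
      encodeList (List.ofFn fun i => encodeCost (I.cost v (numD.symm i)))))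

end Instance

/-- An answer as a tree: `none` is the leaf, and an assignment is a pair whose second component is
the list of the numbers of the labels of the variables `0, …, n - 1`. -/
def encodeAnswer [Fintype D] (numD : D ≃ Fin (Fintype.card D)) {n : ℕ} :
    Option (Fin n → D) → Data
  | none => .nil
  | some A => .cons .nil (encodeList (List.ofFn fun v => encodeNat (numD (A v))))

/-- `MinCostCSP(Γ)` can be `r`-approximated in polynomial time: however the labels and the relations
of `Γ` are numbered, there are a program and a polynomial such that the program, run on any
instance, gives a correct answer within a number of steps that is bounded by the polynomial in the
size of the encoded instance. -/
def PolyTimeApproximable [Fintype D] (Γ : Finset (Relation D)) (r : ℕ) : Prop :=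
  ∀ (numD : D ≃ Fin (Fintype.card D)) (numΓ : {R // R ∈ Γ} ≃ Fin Γ.card),
    ∃ (p : Prog) (b : Polynomial ℕ), ∀ I : Instance Γ,
      ∃ (ans : Option (Fin I.numVars → D)) (t : ℕ),
        Runs p (I.encode numD numΓ) (encodeAnswer numD ans) t ∧
        t ≤ b.eval (I.encode numD numΓ).size ∧
        I.IsApproxAnswer r ans

end CSP

namespace CSP

/-! ## Polynomial time functions between encoded types -/

/-! The algorithm combines propagation with the local ratio method. It keeps a partial assignment
`P` and integer weights `W` on pairs (variable, label). For a free variable `v`, every label `a` is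
tried: `P` together with `(v, a)` is closed under forced pairs, where a pair is forced if it occurs
in every tuple of some constraint that is compatible with the partial assignment. The closures that
leave a compatible tuple in every constraint are the extensions. The lightest one, of weight `m`,
becomes the new `P`, and weight `m` (or whatever is left) is removed from each extension.

The dual discriminator enters only in `IsDualDiscriminatorClosed.override`: if `T` is closed under
propagation and consistent, then overwriting any satisfying assignment by `T` gives a satisfying
assignment. Indeed, let `t` be a tuple of the relation and `u` a tuple compatible with `T`. At a
free coordinate `j` nothing is forced, so some compatible `w` has `w j ≠ u j`. Then `d(t, u, w)` is
compatible with `T`, equals `t` at `j`, and keeps every free coordinate where `u` already equals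
`t`. Treating the coordinates one by one turns `u` into `t` overwritten by `T`. Hence no choice of
an extension ever has to be revised.

For the ratio, let `k` be the number of labels and `M` the sum of the minima `m`. A step removes at
most `k * m` from the total weight, since there are at most `k` extensions. A satisfying assignment,
overwritten by the old `P`, contains one of the extensions, hence loses at least `m`; overwriting it
by the new `P` then costs nothing, because all weight of the chosen extension is gone. So `M` is a
lower bound for the weight of every satisfying assignment. The final `P` has remaining weight zero,
so its original weight was removed entirely and is at most `k * M`. This is `Invariant`, preserved
by `Invariant.assignStep` and evaluated in `answer_assign_eq_some`; `answer_assign_ne_none` covers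
the answer `none`.

Rational and infinite costs are reduced to integer weights by a common denominator and a
prohibitively large weight (`cost_le_of_tableWeight_le`).

For the running time, `PT` is closed under composition, pairing, branching and, the only form of
iteration, folds over lists with accumulators of polynomially bounded size (`PT.foldl_of_bounded`).
The whole algorithm is written with such folds, so that `pt_solve` follows from size estimates. The
relations and the number of labels are constants of the program. -/

/-- Types whose elements are encoded by trees. -/
class Enc (α : Type) where
  enc : α → Data
  inj : Function.Injective enc

open Enc

/-- The size of the tree that encodes an element. -/
def esize {α : Type} [Enc α] (a : α) : ℕ := (enc a).size

theorem Data.size_pos (x : Data) : 0 < x.size := by cases x <;> simp [Data.size]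

theorem esize_pos {α : Type} [Enc α] (a : α) : 0 < esize a := Data.size_pos _

theorem poly_mono (b : Polynomial ℕ) {x y : ℕ} (h : x ≤ y) : b.eval x ≤ b.eval y := by
  induction b using Polynomial.induction_on' with
  | add p q hp hq => simp only [Polynomial.eval_add]; omega
  | monomial n a => simp only [Polynomial.eval_monomial]; gcongr

/-- Each construct pays for the size of its input, so time bounds size. This turns time bounds into
size bounds for intermediate results, which composition needs. -/
theorem Runs.size_le {p : Prog} {x y : Data} {t : ℕ} (h : Runs p x y t) : y.size ≤ t + 1 := by
  induction h with
  | ident x => omega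
  | nil x => simp [Data.size]
  | hd x => cases x <;> simp [Data.size, Data.hd]; omega
  | tl x => cases x <;> simp [Data.size, Data.tl]; omega
  | eq_true x h => have := x.size_pos; simp [Data.size]; omega
  | eq_false x h => simp [Data.size]
  | @cons _ _ x _ _ _ _ _ _ _ _ => have := x.size_pos; simp only [Data.size]; omega
  | seq => omega
  | ite_true => omega
  | ite_false => omega
  | loop_stop => omega
  | loop_step => omega

/-- The function is computed by a program in polynomial time. -/
@[fun_prop]
def PT {α β : Type} [Enc α] [Enc β] (f : α → β) : Prop :=
  ∃ (p : Prog) (b : Polynomial ℕ), ∀ a, ∃ t,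
    Runs p (enc a) (enc (f a)) t ∧ t ≤ b.eval (esize a)

/-- The function is bounded by a polynomial in the size of the encoded argument. -/
def PB {α : Type} [Enc α] (g : α → ℕ) : Prop :=
  ∃ b : Polynomial ℕ, ∀ a, g a ≤ b.eval (esize a)

/-! ### Polynomial bounds and closure properties of polynomial time. -/

section
variable {α β γ σ : Type} [Enc α] [Enc β] [Enc γ] [Enc σ]

theorem PB.mono {f g : α → ℕ} (hg : PB g) (h : ∀ a, f a ≤ g a) : PB f := by
  obtain ⟨b, hb⟩ := hg
  exact ⟨b, fun a => (h a).trans (hb a)⟩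

theorem PB.const (n : ℕ) : PB (fun _ : α => n) := ⟨Polynomial.C n, fun a => by simp⟩

theorem PB.esize : PB (fun a : α => esize a) := ⟨Polynomial.X, fun a => by simp⟩

theorem PB.add {f g : α → ℕ} (hf : PB f) (hg : PB g) : PB (fun a => f a + g a) := by
  obtain ⟨p, hp⟩ := hf
  obtain ⟨q, hq⟩ := hg
  exact ⟨p + q, fun a => by simpa using add_le_add (hp a) (hq a)⟩

theorem PB.mul {f g : α → ℕ} (hf : PB f) (hg : PB g) : PB (fun a => f a * g a) := by
  obtain ⟨p, hp⟩ := hf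
  obtain ⟨q, hq⟩ := hg
  exact ⟨p * q, fun a => by simpa using Nat.mul_le_mul (hp a) (hq a)⟩

theorem PB.eval {f : α → ℕ} (b : Polynomial ℕ) (hf : PB f) : PB (fun a => b.eval (f a)) := by
  obtain ⟨p, hp⟩ := hf
  exact ⟨b.comp p, fun a => by simpa [Polynomial.eval_comp] using poly_mono b (hp a)⟩

theorem PT.pb {f : α → β} (hf : PT f) : PB (fun a => CSP.esize (f a)) := by
  obtain ⟨p, b, h⟩ := hf
  refine ⟨b + 1, fun a => ?_⟩
  obtain ⟨t, h1, h2⟩ := h a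
  have := h1.size_le
  simp only [Polynomial.eval_add, Polynomial.eval_one]
  unfold CSP.esize at *
  omega

theorem PB.comp {g : β → ℕ} {f : α → β} (hg : PB g) (hf : PT f) : PB (fun a => g (f a)) := by
  obtain ⟨b, hb⟩ := hg
  exact (PB.eval b hf.pb).mono fun a => hb _

theorem PT.of_pb {f : α → β} (p : Prog) (g : α → ℕ) (hg : PB g)
    (h : ∀ a, ∃ t, Runs p (enc a) (enc (f a)) t ∧ t ≤ g a) : PT f := by
  obtain ⟨b, hb⟩ := hg
  refine ⟨p, b, fun a => ?_⟩
  obtain ⟨t, h1, h2⟩ := h a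
  exact ⟨t, h1, h2.trans (hb a)⟩

theorem PT.congr {f g : α → β} (hf : PT f) (h : ∀ a, g a = f a) : PT g := by
  rwa [show g = f from funext h]

/-- Programs see only trees, so the type in which a result is interpreted does not matter. -/
theorem PT.of_enc_congr {f : α → β} {g : α → γ} (hg : PT g) (h : ∀ a, enc (f a) = enc (g a)) :
    PT f := by
  obtain ⟨p, b, hp⟩ := hg
  exact ⟨p, b, fun a => h a ▸ hp a⟩

@[fun_prop]
theorem PT.id : PT (fun a : α => a) :=
  .of_pb .ident _ ((PB.const 1).add .esize) fun _ => ⟨_, .ident _, le_rfl⟩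

@[fun_prop]
theorem PT.comp {f : β → γ} {g : α → β} (hf : PT f) (hg : PT g) : PT (fun a => f (g a)) := by
  have hb := hg.pb
  obtain ⟨p, b, hp⟩ := hf
  obtain ⟨q, c, hq⟩ := hg
  refine .of_pb (.seq q p) _ ((((PB.const 1).add .esize).add (.eval c .esize)).add (.eval b hb))
    fun a => ?_
  obtain ⟨s, hs, hs'⟩ := hq a
  obtain ⟨t, ht, ht'⟩ := hp (g a)
  exact ⟨_, .seq hs ht, by unfold esize at *; omega⟩

theorem Runs.exists_const (y : Data) : ∃ p n, ∀ x, ∃ t, Runs p x y t ∧ t ≤ n * (1 + x.size) := by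
  induction y with
  | nil => exact ⟨.nil, 1, fun x => ⟨_, .nil x, by omega⟩⟩
  | cons a b iha ihb =>
    obtain ⟨p, n, hp⟩ := iha
    obtain ⟨q, m, hq⟩ := ihb
    refine ⟨.cons p q, 1 + n + m, fun x => ?_⟩
    obtain ⟨s, hs, hs'⟩ := hp x
    obtain ⟨t, ht, ht'⟩ := hq x
    exact ⟨_, .cons hs ht, by nlinarith⟩

@[fun_prop]
theorem PT.const (b : β) : PT (fun _ : α => b) := by
  obtain ⟨p, n, h⟩ := Runs.exists_const (enc b)
  exact .of_pb p _ ((PB.const n).mul ((PB.const 1).add .esize)) fun a => h (enc a)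

instance : Enc Data := ⟨fun x => x, fun _ _ h => h⟩

instance : Enc (α × β) where
  enc p := .cons (enc p.1) (enc p.2)
  inj p q h := by
    simp only [Data.cons.injEq] at h
    exact Prod.ext (inj h.1) (inj h.2)

theorem enc_pair (a : α) (b : β) : enc (a, b) = .cons (enc a) (enc b) := rfl

theorem esize_pair (a : α) (b : β) : esize (a, b) = esize a + esize b + 1 := rfl

theorem encodeList_injective : Function.Injective encodeList := by
  intro l
  induction l with
  | nil => intro l' h; cases l' <;> simp_all [encodeList]
  | cons a l ih =>
    intro l' h
    cases l' with
    | nil => simp [encodeList] at h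
    | cons b l' =>
      simp only [encodeList, Data.cons.injEq] at h
      rw [h.1, ih h.2]

instance : Enc (List α) where
  enc l := encodeList (l.map enc)
  inj := encodeList_injective.comp (List.map_injective_iff.2 inj)

theorem enc_nil : enc ([] : List α) = .nil := rfl

theorem enc_cons (a : α) (l : List α) : enc (a :: l) = .cons (enc a) (enc l) := rfl

theorem esize_nil : esize ([] : List α) = 1 := rfl

theorem esize_cons (a : α) (l : List α) : esize (a :: l) = esize a + esize l + 1 := rfl

theorem esize_append (l l' : List α) : esize (l ++ l') + 1 = esize l + esize l' := by
  induction l with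
  | nil => simp [esize_nil]; omega
  | cons a l ih => rw [List.cons_append, esize_cons, esize_cons]; omega

theorem esize_reverse (l : List α) : esize l.reverse = esize l := by
  induction l with
  | nil => rfl
  | cons a l ih =>
    have := esize_append l.reverse [a]
    rw [List.reverse_cons, esize_cons]
    rw [esize_cons, esize_nil] at this
    omega

theorem length_le_esize (l : List α) : l.length ≤ esize l := by
  induction l with
  | nil => simp
  | cons a l ih => rw [esize_cons, List.length_cons]; omega

theorem esize_le_of_mem {a : α} {l : List α} (h : a ∈ l) : esize a ≤ esize l := by
  induction l with
  | nil => simp at h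
  | cons b l ih =>
    rw [esize_cons]
    rcases List.mem_cons.1 h with rfl | h
    · omega
    · have := ih h; omega

theorem encodeBool_injective : Function.Injective encodeBool := by
  intro a b; cases a <;> cases b <;> simp [encodeBool]

instance : Enc Bool := ⟨encodeBool, encodeBool_injective⟩

instance : Enc (Option α) where
  enc o := match o with
    | none => .nil
    | some a => .cons .nil (enc a)
  inj := by
    rintro (_ | a) (_ | b) h <;> simp_all [inj.eq_iff]

theorem foldr_bit_bits (n : ℕ) : n.bits.foldr Nat.bit 0 = n := by
  induction n using Nat.binaryRec' with
  | zero => simp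
  | bit b n h ih => rw [Nat.bits_append_bit n b h, List.foldr_cons, ih]

instance : Enc ℕ where
  enc := encodeNat
  inj m n h := by
    have h2 := List.map_injective_iff.2 encodeBool_injective (encodeList_injective h)
    rw [← foldr_bit_bits m, h2, foldr_bit_bits]

@[fun_prop]
theorem PT.prodMk {f : γ → α} {g : γ → β} (hf : PT f) (hg : PT g) : PT (fun c => (f c, g c)) := by
  obtain ⟨p, b, hp⟩ := hf
  obtain ⟨q, c, hq⟩ := hg
  refine .of_pb (.cons p q) _ ((((PB.const 1).add .esize).add (.eval b .esize)).add (.eval c .esize))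
    fun a => ?_
  obtain ⟨s, hs, hs'⟩ := hp a
  obtain ⟨t, ht, ht'⟩ := hq a
  exact ⟨_, .cons hs ht, by unfold esize at *; omega⟩

theorem PT.of_hd {f : α → β} (h : ∀ a, enc (f a) = (enc a).hd) : PT f :=
  .of_pb .hd _ ((PB.const 1).add .esize) fun a => ⟨_, h a ▸ .hd _, le_rfl⟩

theorem PT.of_tl {f : α → β} (h : ∀ a, enc (f a) = (enc a).tl) : PT f :=
  .of_pb .tl _ ((PB.const 1).add .esize) fun a => ⟨_, h a ▸ .tl _, le_rfl⟩

theorem PT.of_enc_eq {f : α → β} (h : ∀ a, enc (f a) = enc a) : PT f :=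
  .of_pb .ident _ ((PB.const 1).add .esize) fun a => ⟨_, (h a).symm ▸ .ident _, le_rfl⟩

@[fun_prop]
theorem pt_enc {f : γ → α} (hf : PT f) : PT (fun c => Enc.enc (f c)) := .of_enc_congr hf fun _ => rfl

@[fun_prop]
theorem PT.fst : PT (Prod.fst : α × β → α) := .of_hd fun _ => rfl

@[fun_prop]
theorem PT.snd : PT (Prod.snd : α × β → β) := .of_tl fun _ => rfl

@[fun_prop]
theorem PT.cond {c : γ → Bool} {f g : γ → α} (hc : PT c) (hf : PT f) (hg : PT g) :
    PT (fun x => bif c x then f x else g x) := by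
  obtain ⟨r, d, hr⟩ := hc
  obtain ⟨p, b, hp⟩ := hf
  obtain ⟨q, e, hq⟩ := hg
  refine .of_pb (.ite r p q) _ (((((PB.const 1).add .esize).add (.eval b .esize)).add
    (.eval d .esize)).add (.eval e .esize)) fun a => ?_
  obtain ⟨s, hs, hs'⟩ := hr a
  cases h : c a with
  | true =>
    obtain ⟨t, ht, ht'⟩ := hp a
    rw [h] at hs
    exact ⟨_, .ite_true hs ht, by unfold esize at *; omega⟩
  | false =>
    obtain ⟨t, ht, ht'⟩ := hq a
    rw [h] at hs
    exact ⟨_, .ite_false hs ht, by unfold esize at *; omega⟩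

-- Encodings are injective, so equality of elements is equality of trees, which `Prog.eq` tests.
@[fun_prop]
theorem PT.decide_eq [DecidableEq α] {f g : γ → α} (hf : PT f) (hg : PT g) :
    PT (fun x => decide (f x = g x)) := by
  have h : PT (fun p : α × α => decide (p.1 = p.2)) := by
    refine .of_pb .eq _ ((PB.const 1).add .esize) fun p => ?_
    by_cases h : p.1 = p.2
    · simp only [h, decide_true]
      exact ⟨_, .eq_true _ (congrArg enc h), le_rfl⟩
    · simp only [h, decide_false]
      exact ⟨_, .eq_false _ fun h' => h (inj h'), le_rfl⟩
  exact h.comp (hf.prodMk hg)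

@[fun_prop]
theorem PT.not {f : γ → Bool} (hf : PT f) : PT (fun x => !f x) :=
  (hf.cond (.const false) (.const true)).congr fun x => by cases f x <;> rfl

@[fun_prop]
theorem PT.and {f g : γ → Bool} (hf : PT f) (hg : PT g) : PT (fun x => f x && g x) :=
  (hf.cond hg (.const false)).congr fun x => by cases f x <;> rfl

@[fun_prop]
theorem PT.or {f g : γ → Bool} (hf : PT f) (hg : PT g) : PT (fun x => f x || g x) :=
  (hf.cond (.const true) hg).congr fun x => by cases f x <;> rfl

@[fun_prop]
theorem PT.listCons {f : γ → α} {g : γ → List α} (hf : PT f) (hg : PT g) :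
    PT (fun x => f x :: g x) :=
  (PT.of_enc_eq (α := α × List α) (f := fun p => p.1 :: p.2) fun _ => rfl).comp (hf.prodMk hg)

@[fun_prop]
theorem PT.some {f : γ → α} (hf : PT f) : PT (fun x => Option.some (f x)) := by
  obtain ⟨p, b, hp⟩ := hf
  refine .of_pb (.cons .nil p) _ (((PB.const 2).add (.mul (.const 2) .esize)).add (.eval b .esize))
    fun a => ?_
  obtain ⟨s, hs, hs'⟩ := hp a
  exact ⟨_, .cons (.nil _) hs, by unfold esize at *; omega⟩

/-! ### Folds over lists. -/

/-- One round of a loop that folds over a list; the tree consists of a context, the accumulator and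
the rest of the list. -/
def foldBody (p : Prog) : Prog :=
  .cons .hd (.cons (.seq (.cons .hd (.cons (.seq .tl .hd) (.seq .tl (.seq .tl .hd)))) p)
    (.seq .tl (.seq .tl .tl)))

theorem Runs.foldBody {p : Prog} {c s a l y : Data} {t : ℕ}
    (h : Runs p (.cons c (.cons s a)) y t) :
    ∃ t', Runs (foldBody p) (.cons c (.cons s (.cons a l))) (.cons c (.cons y l)) t' ∧
      t' ≤ t + 20 * (c.size + s.size + a.size + l.size + 5) := by
  have h1 : Runs .hd (.cons c (.cons s (.cons a l))) c _ := .hd _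
  have h2 : Runs .tl (.cons c (.cons s (.cons a l))) (.cons s (.cons a l)) _ := .tl _
  have h3 : Runs .hd (.cons s (.cons a l)) s _ := .hd _
  have h4 : Runs .tl (.cons s (.cons a l)) (.cons a l) _ := .tl _
  have h5 : Runs .hd (.cons a l) a _ := .hd _
  have h6 : Runs .tl (.cons a l) l _ := .tl _
  refine ⟨_, .cons h1 (.cons (.seq (.cons h1 (.cons (.seq h2 h3) (.seq h2 (.seq h4 h5)))) h)
    (.seq h2 (.seq h4 h6))), ?_⟩
  simp only [Data.size]
  omega

/-- The loop stops when the third component, the rest of the list, is the leaf. The accumulator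
bound `Z` is only required along the actual run, that is, for prefixes of `l`. -/
theorem Runs.fold_loop {p : Prog} {f : σ → α → σ} {c : γ} {B Z : ℕ} (l : List α) (s : σ)
    (hp : ∀ a ∈ l, ∀ s, esize s ≤ Z → ∃ t, Runs p (enc (c, s, a)) (enc (f s a)) t ∧ t ≤ B)
    (hZ : ∀ l', l' <+: l → esize (l'.foldl f s) ≤ Z) :
    ∃ t, Runs (.loop (.seq .tl .tl) (CSP.foldBody p)) (enc (c, s, l))
      (enc (c, l.foldl f s, ([] : List α))) t ∧
      t ≤ (l.length + 1) * (B + 50 * (esize c + Z + esize l + 5)) := by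
  induction l generalizing s with
  | nil =>
    have h0 := hZ [] (List.prefix_refl _)
    refine ⟨_, Runs.loop_stop (.seq (.tl _) (.tl _)), ?_⟩
    simp only [List.foldl_nil, enc_pair, Data.size, Data.tl, List.length_nil] at *
    unfold esize at *
    omega
  | cons a l ih =>
    have h0 : esize s ≤ Z := hZ [] (List.nil_prefix)
    obtain ⟨t, ht, htB⟩ := hp a (by simp) s h0
    obtain ⟨t', ht', htB'⟩ := Runs.foldBody (l := enc l) ht
    obtain ⟨u, hu, huB⟩ := ih (f s a) (fun b hb => hp b (by simp [hb])) fun l' hl' =>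
      hZ (a :: l') (by simpa using hl')
    refine ⟨_, .loop_step (.seq (.tl _) (.tl _)) ht' hu, ?_⟩
    have e1 : (l.length + 1) * (B + 50 * (esize c + Z + esize l + 5)) ≤
      (l.length + 1) * (B + 50 * (esize c + Z + esize (a :: l) + 5)) := by
      rw [esize_cons]; gcongr; omega
    have e2 : ((a :: l).length + 1) * (B + 50 * (esize c + Z + esize (a :: l) + 5)) =
      (l.length + 1) * (B + 50 * (esize c + Z + esize (a :: l) + 5)) +
        (B + 50 * (esize c + Z + esize (a :: l) + 5)) := by
      rw [List.length_cons]; ring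
    rw [e2]
    have e3 := esize_cons a l
    simp only [enc_pair, enc_cons, Data.size, Data.tl] at *
    unfold esize at *
    omega

/-- A polynomial time step alone is not enough, since an accumulator that doubles in every step
becomes exponentially large; hence the separate bound `Z` for all intermediate accumulators. -/
theorem PT.foldl_of_bounded {f : γ → σ → α → σ} {i : γ → σ} {l : γ → List α}
    (hf : PT fun x : γ × σ × α => f x.1 x.2.1 x.2.2) (hi : PT i) (hl : PT l) {Z : γ → ℕ}
    (hZ : PB Z) (h : ∀ c l', l' <+: l c → esize (l'.foldl (f c) (i c)) ≤ Z c) :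
    PT fun c => (l c).foldl (f c) (i c) := by
  have hlb := hl.pb
  have hib := hi.pb
  obtain ⟨p, b, hp⟩ := hf
  obtain ⟨q, d, hq⟩ := hi
  obtain ⟨r, e, hr⟩ := hl
  have key : ∀ c, ∃ t, Runs (.loop (.seq .tl .tl) (CSP.foldBody p)) (enc (c, i c, l c))
      (enc (c, (l c).foldl (f c) (i c), ([] : List α))) t ∧
      t ≤ (esize (l c) + 1) * (b.eval (esize c + Z c + esize (l c) + 2) +
        50 * (esize c + Z c + esize (l c) + 5)) := by
    intro c
    have hp' : ∀ a ∈ l c, ∀ s, esize s ≤ Z c → ∃ t, Runs p (enc (c, s, a)) (enc (f c s a)) t ∧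
        t ≤ b.eval (esize c + Z c + esize (l c) + 2) := by
      intro a ha s hs
      obtain ⟨t, h1, h2⟩ := hp (c, s, a)
      refine ⟨t, h1, h2.trans (poly_mono b ?_)⟩
      have := esize_le_of_mem ha
      rw [esize_pair, esize_pair]
      omega
    obtain ⟨t, h1, h2⟩ := Runs.fold_loop (l c) (i c) hp' (h c)
    exact ⟨t, h1, h2.trans (by gcongr; exact length_le_esize _)⟩
  -- The program builds context, initial accumulator and list, runs the loop, and extracts the
  -- accumulator from the middle.
  refine .of_pb (.seq (.cons .ident (.cons q r)) (.seq (.loop (.seq .tl .tl) (CSP.foldBody p))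
    (.seq .tl .hd))) (fun c => 20 * (esize c + esize (i c) + esize (l c) + Z c + 5) +
      d.eval (esize c) + e.eval (esize c) +
      (esize (l c) + 1) * (b.eval (esize c + Z c + esize (l c) + 2) +
        50 * (esize c + Z c + esize (l c) + 5))) ?_ fun c => ?_
  · exact ((((PB.const 20).mul ((((PB.esize.add hib).add hlb).add hZ).add (.const 5))).add
      (.eval d .esize)).add (.eval e .esize)).add ((hlb.add (.const 1)).mul
      ((PB.eval b (((PB.esize.add hZ).add hlb).add (.const 2))).add
        ((PB.const 50).mul (((PB.esize.add hZ).add hlb).add (.const 5)))))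
  · obtain ⟨t, ht, ht'⟩ := key c
    obtain ⟨s, hs, hs'⟩ := hq c
    obtain ⟨u, hu, hu'⟩ := hr c
    have h0 := h c (l c) (List.prefix_refl _)
    refine ⟨_, .seq (.cons (.ident _) (.cons hs hu)) (.seq ht (.seq (.tl _) (.hd _))), ?_⟩
    simp only [enc_pair, Data.size, Data.tl, enc_nil] at *
    unfold esize at *
    omega

/-- A fold over a list is polynomial time if a measure of the accumulator grows by a bounded amount
in each step. -/
theorem PT.foldl_of_measure {f : γ → σ → α → σ} {i : γ → σ} {l : γ → List α}
    (hf : PT fun x : γ × σ × α => f x.1 x.2.1 x.2.2) (hi : PT i) (hl : PT l) (μ : σ → ℕ) (k : ℕ)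
    (h1 : ∀ s, esize s ≤ k * μ s + k) (h2 : ∀ s, μ s ≤ k * esize s + k) {g : γ → α → ℕ}
    (hg : PB fun x : γ × α => g x.1 x.2)
    (h : ∀ c s a, μ (f c s a) ≤ μ s + g c a) : PT fun c => (l c).foldl (f c) (i c) := by
  have hlb := hl.pb
  have hib := hi.pb
  obtain ⟨b, hb⟩ := hg
  have key : ∀ c s (l' : List α) N, (∀ a ∈ l', esize a ≤ N) →
      μ (l'.foldl (f c) s) ≤ μ s + l'.length * b.eval (esize c + N + 1) := by
    intro c s l'
    induction l' generalizing s with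
    | nil => intros; simp
    | cons a l' ih =>
      intro N hN
      have h3 := ih (f c s a) N fun a ha => hN a (by simp [ha])
      have h4 := h c s a
      have h5 : g c a ≤ _ := hb (c, a)
      have h6 : b.eval (esize (c, a)) ≤ b.eval (esize c + N + 1) := poly_mono b (by
        rw [esize_pair]; have := hN a (by simp); omega)
      rw [List.foldl_cons, List.length_cons, add_mul, one_mul]
      omega
  refine .foldl_of_bounded hf hi hl (Z := fun c => k * ((k * esize (i c) + k) +
    esize (l c) * b.eval (esize c + esize (l c) + 1)) + k) ?_ fun c l' hl' => ?_
  · exact ((PB.const k).mul ((((PB.const k).mul hib).add (.const k)).add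
      (hlb.mul (.eval b ((PB.esize.add hlb).add (.const 1)))))).add (.const k)
  · have h3 := key c (i c) l' (esize (l c)) fun a ha => esize_le_of_mem (hl'.subset ha)
    have h4 : l'.length ≤ esize (l c) := hl'.length_le.trans (length_le_esize _)
    refine (h1 _).trans ?_
    gcongr
    refine h3.trans ?_
    gcongr
    exact h2 _

theorem PT.foldl {f : γ → σ → α → σ} {i : γ → σ} {l : γ → List α}
    (hf : PT fun x : γ × σ × α => f x.1 x.2.1 x.2.2) (hi : PT i) (hl : PT l) {g : γ → α → ℕ}
    (hg : PB fun x : γ × α => g x.1 x.2) (h : ∀ c s a, esize (f c s a) ≤ esize s + g c a) :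
    PT fun c => (l c).foldl (f c) (i c) :=
  .foldl_of_measure hf hi hl esize 1 (by intros; omega) (by intros; omega) hg h

end

section
variable {α β γ σ : Type} [Enc α] [Enc β] [Enc γ] [Enc σ]

/-! ## Lists -/

@[fun_prop]
theorem PT.reverse {l : γ → List α} (hl : PT l) : PT fun c => (l c).reverse :=
  (PT.foldl (f := fun _ s a => a :: s) (i := fun _ => []) (by fun_prop) (by fun_prop) hl
    (g := fun _ a => esize a + 1) ((PB.comp .esize .snd).add (.const 1))
    fun c s a => by rw [esize_cons]; omega).congr fun c => by
      rw [← List.foldr_reverse, List.foldr_cons_eq_append]; simp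

@[fun_prop]
theorem PT.append {l l' : γ → List α} (hl : PT l) (hl' : PT l') : PT fun c => l c ++ l' c :=
  (PT.foldl (f := fun _ s a => a :: s) (i := l') (l := fun c => (l c).reverse) (by fun_prop)
    (by fun_prop) (by fun_prop)
    (g := fun _ a => esize a + 1) ((PB.comp .esize .snd).add (.const 1))
    fun c s a => by rw [esize_cons]; omega).congr fun c => by simp

theorem PT.map {f : γ → α → β} {l : γ → List α} (hf : PT fun x : γ × α => f x.1 x.2) (hl : PT l) :
    PT fun c => (l c).map (f c) := by
  have hf' : PT fun x : γ × List β × α => f x.1 x.2.2 := hf.comp (g := fun x : γ × List β × α => (x.1, x.2.2))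
    (by fun_prop)
  have h := PT.foldl (f := fun c s a => f c a :: s) (i := fun _ => []) (by fun_prop)
    (by fun_prop) hl (g := fun c a => esize (f c a) + 1) (hf.pb.add (.const 1))
    fun c s a => by rw [esize_cons]; omega
  refine h.reverse.congr fun c => ?_
  suffices ∀ s : List β, (l c).foldl (fun s a => f c a :: s) s = ((l c).map (f c)).reverse ++ s by
    simp [this]
  induction l c with
  | nil => simp
  | cons a l ih => intro s; simp [ih]

theorem PT.filter {p : γ → α → Bool} {l : γ → List α} (hp : PT fun x : γ × α => p x.1 x.2)
    (hl : PT l) : PT fun c => (l c).filter (p c) := by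
  have hf' : PT fun x : γ × List α × α => p x.1 x.2.2 := hp.comp (g := fun x : γ × List α × α => (x.1, x.2.2))
    (by fun_prop)
  have h := PT.foldl (f := fun c s a => bif p c a then a :: s else s) (i := fun _ => [])
    (by fun_prop) (by fun_prop) hl (g := fun _ a => esize a + 1)
    ((PB.comp .esize .snd).add (.const 1))
    fun c s a => by cases p c a <;> simp [esize_cons]; omega
  refine h.reverse.congr fun c => ?_
  suffices ∀ s : List α, (l c).foldl (fun s a => bif p c a then a :: s else s) s =
      ((l c).filter (p c)).reverse ++ s by
    simp [this]
  induction l c with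
  | nil => simp
  | cons a l ih => intro s; cases h : p c a <;> simp [ih, h]

theorem PT.flatMap {f : γ → α → List β} {l : γ → List α} (hf : PT fun x : γ × α => f x.1 x.2)
    (hl : PT l) : PT fun c => (l c).flatMap (f c) := by
  have hf' : PT fun x : γ × List β × α => f x.1 x.2.2 := hf.comp (g := fun x : γ × List β × α => (x.1, x.2.2))
    (by fun_prop)
  have h := PT.foldl (f := fun c s a => s ++ f c a) (i := fun _ => []) (by fun_prop)
    (by fun_prop) hl (g := fun c a => esize (f c a)) hf.pb
    fun c s a => by have := esize_append s (f c a); omega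
  refine h.congr fun c => ?_
  suffices ∀ s : List β, (l c).foldl (fun s a => s ++ f c a) s = s ++ (l c).flatMap (f c) by
    simp [this]
  induction l c with
  | nil => simp
  | cons a l ih => intro s; simp [ih]

theorem esize_bool_le (b : Bool) : esize b ≤ 3 := by cases b <;> decide

theorem PT.all {p : γ → α → Bool} {l : γ → List α} (hp : PT fun x : γ × α => p x.1 x.2)
    (hl : PT l) : PT fun c => (l c).all (p c) := by
  have hf' : PT fun x : γ × Bool × α => p x.1 x.2.2 := hp.comp (g := fun x : γ × Bool × α => (x.1, x.2.2))
    (by fun_prop)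
  have h := PT.foldl (f := fun c s a => s && p c a) (i := fun _ => true)
    (by fun_prop) (by fun_prop) hl (g := fun _ _ => 3) (.const 3)
    fun c s a => (esize_bool_le _).trans (by omega)
  refine h.congr fun c => ?_
  suffices ∀ s : Bool, (l c).foldl (fun s a => s && p c a) s = (s && (l c).all (p c)) by
    simp [this]
  induction l c with
  | nil => simp
  | cons a l ih => intro s; simp [ih, Bool.and_assoc]

theorem PT.any {p : γ → α → Bool} {l : γ → List α} (hp : PT fun x : γ × α => p x.1 x.2)
    (hl : PT l) : PT fun c => (l c).any (p c) :=
  (PT.not (PT.all (p := fun c a => !p c a) (by fun_prop) hl)).congr fun c => by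
    rw [List.not_all_eq_any_not]; simp

@[fun_prop]
theorem PT.isEmpty {l : γ → List α} (hl : PT l) : PT fun c => (l c).isEmpty := by
  classical
  exact (PT.decide_eq hl (.const [])).congr fun c => by cases l c <;> simp

@[fun_prop]
theorem PT.tail {l : γ → List α} (hl : PT l) : PT fun c => (l c).tail :=
  (PT.of_tl (f := fun l : List α => l.tail) fun l => by cases l <;> rfl).comp hl

@[fun_prop]
theorem PT.headD_nil {l : γ → List (List α)} (hl : PT l) : PT fun c => (l c).headD [] :=
  (PT.of_hd (f := fun l : List (List α) => l.headD []) fun l => by cases l <;> rfl).comp hl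

theorem enc_zero : enc 0 = Data.nil := by
  change encodeNat 0 = _
  simp [encodeNat, encodeList]

@[fun_prop]
theorem PT.headD_zero {l : γ → List ℕ} (hl : PT l) : PT fun c => (l c).headD 0 :=
  (PT.of_hd (f := fun l : List ℕ => l.headD 0) fun l => by
    cases l
    · exact enc_zero
    · rfl).comp hl

@[fun_prop]
theorem PT.getD_nil {o : γ → Option (List α)} (ho : PT o) : PT fun c => (o c).getD [] :=
  (PT.of_tl (f := fun o : Option (List α) => o.getD []) fun o => by cases o <;> rfl).comp ho

@[fun_prop]
theorem PT.getD_zero {o : γ → Option ℕ} (ho : PT o) : PT fun c => (o c).getD 0 :=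
  (PT.of_tl (f := fun o : Option ℕ => o.getD 0) fun o => by
    cases o
    · exact enc_zero
    · rfl).comp ho

/-- The value of the first pair with a given key. -/
def look (T : List (ℕ × β)) (x : ℕ) : Option β :=
  T.foldl (fun s p => bif s.isNone && decide (p.1 = x) then some p.2 else s) none

omit [Enc β] in
theorem look_nil (x : ℕ) : look ([] : List (ℕ × β)) x = none := rfl

-- Once the fold has found a value it never changes it, so the fold agrees with the recursive
-- search.
omit [Enc β] in
theorem look_cons (p : ℕ × β) (T : List (ℕ × β)) (x : ℕ) :
    look (p :: T) x = if p.1 = x then some p.2 else look T x := by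
  have h : ∀ (T : List (ℕ × β)) b,
      T.foldl (fun s p => bif s.isNone && decide (p.1 = x) then some p.2 else s) (some b) =
        some b := by
    intro T b
    induction T with
    | nil => rfl
    | cons p T ih => simpa using ih
  unfold look
  by_cases hp : p.1 = x
  · simp [hp, h]
  · simp [hp]

@[fun_prop]
theorem PT.isNone {o : γ → Option α} (ho : PT o) : PT fun c => (o c).isNone := by
  classical
  exact (PT.decide_eq ho (.const none)).congr fun c => by cases o c <;> simp

theorem esize_some (a : α) : esize (some a) = esize a + 2 := by
  change 1 + esize a + 1 = _; omega

@[fun_prop]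
theorem pt_look {T : γ → List (ℕ × β)} {x : γ → ℕ} (hT : PT T) (hx : PT x) :
    PT fun c => look (T c) (x c) :=
  PT.foldl (f := fun c s p => bif s.isNone && decide (p.1 = x c) then Option.some p.2 else s)
    (by fun_prop) (by fun_prop) hT (g := fun _ a => esize a + 2)
    ((PB.comp .esize .snd).add (.const 2)) fun c s p => by
      cases s.isNone && decide (p.1 = x c)
      · simp
      · simp only [cond_true, esize_some]
        have := esize_pair p.1 p.2
        simp only [Prod.mk.eta] at this
        omega

/-! ## Natural numbers -/

@[fun_prop]
theorem PT.bits {f : γ → ℕ} (hf : PT f) : PT fun c => (f c).bits :=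
  (PT.of_enc_eq (f := Nat.bits) fun _ => rfl).comp hf

@[fun_prop]
theorem PT.bodd {f : γ → ℕ} (hf : PT f) : PT fun c => (f c).bodd := by
  refine (PT.of_hd (f := Nat.bodd) fun n => ?_).comp hf
  change encodeBool _ = (encodeNat n).hd
  rw [Nat.bodd_eq_bits_head, encodeNat]
  cases n.bits <;> rfl

@[fun_prop]
theorem PT.div2 {f : γ → ℕ} (hf : PT f) : PT fun c => (f c).div2 := by
  refine (PT.of_tl (f := Nat.div2) fun n => ?_).comp hf
  change encodeNat _ = (encodeNat n).tl
  rw [encodeNat, encodeNat, Nat.div2_bits_eq_tail]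
  cases n.bits <;> rfl

/-- The hypothesis excludes a leading zero: `Nat.bit false 0` is `0`, whose encoding is the leaf. -/
theorem enc_bit {b : Bool} {n : ℕ} (h : n = 0 → b = true) :
    enc (Nat.bit b n) = .cons (enc b) (enc n) := by
  change encodeNat _ = .cons (encodeBool b) (encodeNat n)
  rw [encodeNat, Nat.bits_append_bit n b h]
  rfl

@[fun_prop]
theorem PT.bit {b : γ → Bool} {n : γ → ℕ} (hb : PT b) (hn : PT n) :
    PT fun c => Nat.bit (b c) (n c) := by
  refine .of_enc_congr (g := fun c => bif decide (n c = 0) && !b c then Data.nil else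
    enc (b c, n c)) (by fun_prop) fun c => ?_
  by_cases h : n c = 0 → b c = true
  · rw [enc_bit h]
    by_cases h0 : n c = 0
    · simp [h0, h h0]; rfl
    · simp [h0]; rfl
  · simp only [Classical.not_imp, Bool.not_eq_true] at h
    simp only [h, Nat.bit_false, mul_zero, enc_zero]
    rfl

theorem esize_bit_le (b : Bool) (n : ℕ) : esize (Nat.bit b n) ≤ esize n + 4 := by
  by_cases h : n = 0 → b = true
  · have h1 := esize_bool_le b
    have h2 : esize (Nat.bit b n) = esize b + esize n + 1 := by
      unfold esize; rw [enc_bit h]; rfl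
    omega
  · simp only [Classical.not_imp, Bool.not_eq_true] at h
    simp [h]

/-- The number whose binary representation is obtained from that of `n` by putting the given bits
in front of it, one after another. -/
def pushBits (l : List Bool) (n : ℕ) : ℕ := l.foldl (fun n b => Nat.bit b n) n

@[fun_prop]
theorem pt_pushBits {l : γ → List Bool} {n : γ → ℕ} (hl : PT l) (hn : PT n) :
    PT fun c => pushBits (l c) (n c) :=
  PT.foldl (f := fun _ n b => Nat.bit b n) (by fun_prop) hn hl (g := fun _ _ => 4) (.const 4)
    fun _ n b => esize_bit_le b n

/-- One step of the addition of `y` to a number that is read bit by bit: the state consists of the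
rest of `y`, the carry, and the bits that have been found. -/
def addStep (s : ℕ × Bool × List Bool) (b : Bool) : ℕ × Bool × List Bool :=
  (s.1.div2, (b && s.1.bodd || s.2.1 && (b || s.1.bodd)), (b ^^ s.1.bodd ^^ s.2.1) :: s.2.2)

/-- The loop invariant of schoolbook addition. The list of found bits has the most significant one
at its head, so `pushBits` puts them back below the part that is still to be added. -/
theorem pushBits_addStep (l : List Bool) (s : ℕ × Bool × List Bool) :
    pushBits (l.foldl addStep s).2.2 ((l.foldl addStep s).1 + (l.foldl addStep s).2.1.toNat) =
      pushBits s.2.2 (l.foldr Nat.bit 0 + s.1 + s.2.1.toNat) := by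
  induction l generalizing s with
  | nil => simp
  | cons b l ih =>
    obtain ⟨y, c, acc⟩ := s
    rw [List.foldl_cons, ih, List.foldr_cons]
    simp only [addStep, pushBits, List.foldl_cons]
    congr 1
    obtain ⟨d, z, rfl⟩ : ∃ d z, y = Nat.bit d z := ⟨_, _, (Nat.bit_bodd_div2 y).symm⟩
    rw [Nat.bodd_bit, Nat.div2_bit]
    cases b <;> cases c <;> cases d <;> simp [Nat.bit_val] <;> ring

@[fun_prop]
theorem PT.xor {f g : γ → Bool} (hf : PT f) (hg : PT g) : PT (fun x => f x ^^ g x) :=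
  (hf.cond hg.not hg).congr fun x => by cases f x <;> simp

theorem esize_div2_le (n : ℕ) : esize n.div2 ≤ esize n := by
  conv_rhs => rw [← Nat.bit_bodd_div2 n]
  by_cases h : n.div2 = 0 → n.bodd = true
  · have h2 : esize (Nat.bit n.bodd n.div2) = esize n.bodd + esize n.div2 + 1 := by
      unfold esize; rw [enc_bit h]; rfl
    omega
  · simp only [Classical.not_imp, Bool.not_eq_true] at h
    simp [h]

theorem PT.foldl_addStep {l : γ → List Bool} {i : γ → ℕ × Bool × List Bool} (hl : PT l)
    (hi : PT i) : PT fun c => (l c).foldl addStep (i c) := by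
  refine PT.foldl (f := fun _ => addStep) (by unfold addStep; fun_prop) hi hl
    (g := fun _ _ => 10) (.const 10) fun _ s b => ?_
  obtain ⟨y, c, acc⟩ := s
  simp only [addStep, esize_pair, esize_cons]
  have h1 := esize_div2_le y
  have h2 := esize_bool_le (b && y.bodd || c && (b || y.bodd))
  have h3 := esize_bool_le (b ^^ y.bodd ^^ c)
  omega

/-- The successor is the addition of `0` with an initial carry. Only the carry can be left at the
end, whereas general addition leaves a number plus a carry and therefore needs the successor first.
-/
theorem succ_eq (n : ℕ) : n + 1 = pushBits (n.bits.foldl addStep (0, true, [])).2.2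
    (bif (n.bits.foldl addStep (0, true, [])).2.1 then 1 else 0) := by
  have h := pushBits_addStep n.bits (0, true, [])
  have h0 : ∀ (l : List Bool) s, s.1 = 0 → (l.foldl addStep s).1 = 0 := by
    intro l
    induction l with
    | nil => simp
    | cons b l ih => intro s hs; exact ih _ (by simp [addStep, hs])
  rw [foldr_bit_bits, h0 _ _ rfl] at h
  simp only [pushBits, List.foldl_nil, Bool.toNat_true, add_zero, zero_add] at h ⊢
  rw [← h]
  cases (n.bits.foldl addStep (0, true, [])).2.1 <;> rfl

@[fun_prop]
theorem PT.succ {f : γ → ℕ} (hf : PT f) : PT fun c => f c + 1 := by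
  have h : PT fun c => (f c).bits.foldl addStep (0, true, []) :=
    .foldl_addStep (by fun_prop) (by fun_prop)
  refine PT.congr ?_ fun c => succ_eq (f c)
  fun_prop

@[fun_prop]
theorem PT.add {f g : γ → ℕ} (hf : PT f) (hg : PT g) : PT fun c => f c + g c := by
  have h : PT fun c => (f c).bits.foldl addStep (g c, false, []) :=
    .foldl_addStep (by fun_prop) (by fun_prop)
  have h2 : PT fun c => pushBits ((f c).bits.foldl addStep (g c, false, [])).2.2
      (bif ((f c).bits.foldl addStep (g c, false, [])).2.1 then
        ((f c).bits.foldl addStep (g c, false, [])).1 + 1 else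
        ((f c).bits.foldl addStep (g c, false, [])).1) := by
    fun_prop
  refine h2.congr fun c => ?_
  have h3 := pushBits_addStep (f c).bits (g c, false, [])
  rw [foldr_bit_bits] at h3
  simp only [pushBits, List.foldl_nil, Bool.toNat_false, add_zero] at h3 ⊢
  rw [← h3]
  cases ((f c).bits.foldl addStep (g c, false, [])).2.1 <;> rfl

/-- One step of the subtraction of `y` from a number that is read bit by bit. -/
def subStep (s : ℕ × Bool × List Bool) (b : Bool) : ℕ × Bool × List Bool :=
  (s.1.div2, (!b && s.1.bodd || s.2.1 && (!b || s.1.bodd)), (b ^^ s.1.bodd ^^ s.2.1) :: s.2.2)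

theorem PT.foldl_subStep {l : γ → List Bool} {i : γ → ℕ × Bool × List Bool} (hl : PT l)
    (hi : PT i) : PT fun c => (l c).foldl subStep (i c) := by
  refine PT.foldl (f := fun _ => subStep) (by unfold subStep; fun_prop) hi hl
    (g := fun _ _ => 10) (.const 10) fun _ s b => ?_
  obtain ⟨y, c, acc⟩ := s
  simp only [subStep, esize_pair, esize_cons]
  have h1 := esize_div2_le y
  have h2 := esize_bool_le (!b && y.bodd || c && (!b || y.bodd))
  have h3 := esize_bool_le (b ^^ y.bodd ^^ c)
  omega

/-- The invariant is stated over `ℤ` because the high part is negative if a borrow or a part of `y`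
remains. -/
theorem foldl_subStep_eq (l : List Bool) (s : ℕ × Bool × List Bool) :
    (l.foldl subStep s).2.2.foldl (fun (z : ℤ) b => 2 * z + b.toNat)
        (-((l.foldl subStep s).1 : ℤ) - (l.foldl subStep s).2.1.toNat) =
      s.2.2.foldl (fun (z : ℤ) b => 2 * z + b.toNat)
        ((l.foldr Nat.bit 0 : ℕ) - (s.1 : ℤ) - s.2.1.toNat) := by
  induction l generalizing s with
  | nil => simp
  | cons b l ih =>
    obtain ⟨y, c, acc⟩ := s
    rw [List.foldl_cons, ih, List.foldr_cons]
    simp only [subStep, List.foldl_cons]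
    congr 1
    obtain ⟨d, z, rfl⟩ : ∃ d z, y = Nat.bit d z := ⟨_, _, (Nat.bit_bodd_div2 y).symm⟩
    rw [Nat.bodd_bit, Nat.div2_bit]
    cases b <;> cases c <;> cases d <;> simp [Nat.bit_val] <;> ring

theorem sub_eq (x y : ℕ) : x - y =
    bif decide ((x.bits.foldl subStep (y, false, [])).1 = 0) &&
      !(x.bits.foldl subStep (y, false, [])).2.1
    then pushBits (x.bits.foldl subStep (y, false, [])).2.2 0 else 0 := by
  have h := foldl_subStep_eq x.bits (y, false, [])
  rw [foldr_bit_bits] at h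
  simp only [List.foldl_nil, Bool.toNat_false, Nat.cast_zero, sub_zero] at h
  generalize x.bits.foldl subStep (y, false, []) = s at *
  obtain ⟨z, c, acc⟩ := s
  -- Appending low bits to a negative number keeps it negative, so a remaining borrow or rest of `y`
  -- means that the truncated difference is zero.
  have hneg : ∀ (l : List Bool) (z : ℤ), z ≤ -1 →
      l.foldl (fun (z : ℤ) b => 2 * z + b.toNat) z ≤ -1 := by
    intro l
    induction l with
    | nil => simp
    | cons b l ih => intro z hz; exact ih _ (by cases b <;> simp <;> omega)
  have hpos : ∀ (l : List Bool) (n : ℕ), ((pushBits l n : ℕ) : ℤ) =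
      l.foldl (fun (z : ℤ) b => 2 * z + b.toNat) n := by
    intro l
    induction l with
    | nil => simp [pushBits]
    | cons b l ih =>
      intro n
      have := ih (Nat.bit b n)
      simp only [pushBits, List.foldl_cons] at this ⊢
      rw [this, Nat.bit_val]
      push_cast
      rfl
  by_cases hz : z = 0 ∧ c = false
  · obtain ⟨rfl, rfl⟩ := hz
    have := hpos acc 0
    simp at h this ⊢
    omega
  · have h2 := hneg acc (-(z : ℤ) - c.toNat) (by cases c <;> simp_all; omega)
    have h3 : (decide (z = 0) && !c) = false := by
      cases c <;> simp_all
    simp only [h3, cond_false]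
    simp only at h
    omega

@[fun_prop]
theorem PT.sub {f g : γ → ℕ} (hf : PT f) (hg : PT g) : PT fun c => f c - g c := by
  have h : PT fun c => (f c).bits.foldl subStep (g c, false, []) :=
    .foldl_subStep (by fun_prop) (by fun_prop)
  refine PT.congr ?_ fun c => sub_eq (f c) (g c)
  fun_prop

@[fun_prop]
theorem PT.decide_le {f g : γ → ℕ} (hf : PT f) (hg : PT g) : PT fun c => decide (f c ≤ g c) :=
  PT.congr (f := fun c => decide (f c - g c = 0)) (by fun_prop) fun c => by
    simp [Nat.sub_eq_zero_iff_le]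

theorem size_bit_le (b : Bool) (n : ℕ) : (Nat.bit b n).size ≤ n.size + 1 := by
  by_cases h : Nat.bit b n = 0
  · simp [h]
  · rw [Nat.size_bit h]

theorem esize_le_size (n : ℕ) : esize n ≤ 4 * n.size + 1 := by
  induction n using Nat.binaryRec' with
  | zero => simp [esize, enc_zero, Data.size]
  | bit b n h ih =>
    by_cases h0 : Nat.bit b n = 0
    · rw [h0]; simp [esize, enc_zero, Data.size]
    · rw [Nat.size_bit h0]
      have := esize_bit_le b n
      omega

theorem size_le_esize (n : ℕ) : n.size ≤ esize n := by
  induction n using Nat.binaryRec' with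
  | zero => simp
  | bit b n h ih =>
    have h2 : esize (Nat.bit b n) = esize b + esize n + 1 := by
      unfold esize; rw [enc_bit h]; rfl
    have := size_bit_le b n
    omega

/-- Crude, but it has the form that `PT.foldl_nat` asks for: the growth depends on the new summand
and not on the accumulator. For positive numbers it comes from `2 ^ a + 2 ^ b ≤ 2 ^ a * 2 ^ b` with
`a, b ≥ 1`. -/
theorem size_add_le (m n : ℕ) : (m + n).size ≤ m.size + n.size := by
  rcases Nat.eq_zero_or_pos m with rfl | hm
  · simp
  rcases Nat.eq_zero_or_pos n with rfl | hn
  · simp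
  rw [Nat.size_le]
  have h1 := Nat.lt_size_self m
  have h2 := Nat.lt_size_self n
  rw [pow_add]
  have h3 : 2 ^ 1 ≤ 2 ^ m.size := Nat.pow_le_pow_right (by norm_num) (Nat.size_pos.2 hm)
  have h4 : 2 ^ 1 ≤ 2 ^ n.size := Nat.pow_le_pow_right (by norm_num) (Nat.size_pos.2 hn)
  nlinarith

theorem size_mul_le (m n : ℕ) : (m * n).size ≤ m.size + n.size := by
  rw [Nat.size_le, pow_add]
  exact Nat.mul_lt_mul'' (Nat.lt_size_self m) (Nat.lt_size_self n)

/-- A fold with values in the natural numbers is polynomial time if the length of the binary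
representation of the accumulator grows by a bounded amount in each step. -/
theorem PT.foldl_nat {f : γ → ℕ → α → ℕ} {i : γ → ℕ} {l : γ → List α}
    (hf : PT fun x : γ × ℕ × α => f x.1 x.2.1 x.2.2) (hi : PT i) (hl : PT l) {g : γ → α → ℕ}
    (hg : PB fun x : γ × α => g x.1 x.2) (h : ∀ c s a, (f c s a).size ≤ s.size + g c a) :
    PT fun c => (l c).foldl (f c) (i c) :=
  .foldl_of_measure hf hi hl Nat.size 4 (fun n => (esize_le_size n).trans (by omega))
    (fun n => (size_le_esize n).trans (by omega)) hg h

@[fun_prop]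
theorem PT.mul {f g : γ → ℕ} (hf : PT f) (hg : PT g) : PT fun c => f c * g c := by
  -- Horner's scheme, from the most significant bit of `f c` downwards.
  have h : PT fun c => (f c).bits.reverse.foldl
      (fun s b => bif b then Nat.bit false s + g c else Nat.bit false s) 0 := by
    refine PT.foldl_nat (f := fun c s b => bif b then Nat.bit false s + g c else Nat.bit false s)
      ?_ (by fun_prop) (by fun_prop) (g := fun c _ => (g c).size + 1) ?_ fun c s b => ?_
    · have : PT fun x : γ × ℕ × Bool => g x.1 := hg.comp (by fun_prop)
      fun_prop
    · exact ((PB.comp hg.pb .fst).mono fun x => size_le_esize _).add (.const 1)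
    · have h1 := size_bit_le false s
      have h2 := size_add_le (Nat.bit false s) (g c)
      cases b <;> simp only [cond_true, cond_false] <;> omega
  refine h.congr fun c => ?_
  rw [List.foldl_reverse]
  conv_lhs => rw [← foldr_bit_bits (f c)]
  induction (f c).bits with
  | nil => simp
  | cons b l ih =>
    rw [List.foldr_cons, List.foldr_cons, ← ih]
    cases b <;> simp [Nat.bit_val] <;> ring

theorem PT.sum_map {f : γ → α → ℕ} {l : γ → List α} (hf : PT fun x : γ × α => f x.1 x.2)
    (hl : PT l) : PT fun c => ((l c).map (f c)).sum := by
  have hf' : PT fun x : γ × ℕ × α => f x.1 x.2.2 := hf.comp (g := fun x : γ × ℕ × α => (x.1, x.2.2))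
    (by fun_prop)
  have h := PT.foldl_nat (f := fun c s a => s + f c a) (i := fun _ => 0) (by fun_prop)
    (by fun_prop) hl (g := fun c a => (f c a).size) (hf.pb.mono fun x => size_le_esize _)
    fun c s a => size_add_le _ _
  refine h.congr fun c => ?_
  rw [List.sum_eq_foldl, List.foldl_map]

theorem PT.prod_map {f : γ → α → ℕ} {l : γ → List α} (hf : PT fun x : γ × α => f x.1 x.2)
    (hl : PT l) : PT fun c => ((l c).map (f c)).prod := by
  have hf' : PT fun x : γ × ℕ × α => f x.1 x.2.2 := hf.comp (g := fun x : γ × ℕ × α => (x.1, x.2.2))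
    (by fun_prop)
  have h := PT.foldl_nat (f := fun c s a => s * f c a) (i := fun _ => 1) (by fun_prop)
    (by fun_prop) hl (g := fun c a => (f c a).size) (hf.pb.mono fun x => size_le_esize _)
    fun c s a => size_mul_le _ _
  refine h.congr fun c => ?_
  rw [List.prod_eq_foldl, List.foldl_map]

end

/-! ## The algorithm

A partial assignment is a list of pairs of a variable and a label; a constraint is given by the list
of its tuples, each of which is a list of such pairs. -/

/-- No pair of `u` contradicts the partial assignment `T`. -/
def compat (T u : List (ℕ × ℕ)) : Bool :=
  u.all fun p => (look T p.1).isNone || decide (look T p.1 = some p.2)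

/-- Add `p` to the partial assignment `T` if its variable is free and all tuples of `L` contain
`p`. -/
def addForced (L : List (List (ℕ × ℕ))) (T : List (ℕ × ℕ)) (p : ℕ × ℕ) : List (ℕ × ℕ) :=
  bif (look T p.1).isNone && L.all (fun u => u.any fun q => decide (p = q)) then p :: T else T

/-- Add the pairs that are implied by `T` and the constraint `C`. -/
def propagate (T : List (ℕ × ℕ)) (C : List (List (ℕ × ℕ))) : List (ℕ × ℕ) :=
  ((C.filter (compat T)).headD []).foldl (addForced (C.filter (compat T))) T

/-- Propagate along all constraints, as many times as there are variables. -/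
def closure (cs : List (List (List (ℕ × ℕ)))) (vars : List ℕ) (T : List (ℕ × ℕ)) : List (ℕ × ℕ) :=
  vars.foldl (fun T _ => cs.foldl propagate T) T

/-- Every constraint has a tuple that does not contradict `T`. -/
def consistent (cs : List (List (List (ℕ × ℕ)))) (T : List (ℕ × ℕ)) : Bool :=
  cs.all fun C => C.any (compat T)

/-- The consistent closures of the extensions of `P` by a label of `v`. -/
def extensions (cs : List (List (List (ℕ × ℕ)))) (vars labels : List ℕ) (P : List (ℕ × ℕ)) (v : ℕ) :
    List (List (ℕ × ℕ)) :=
  (labels.map fun a => closure cs vars ((v, a) :: P)).filter (consistent cs)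

/-- The weight of a partial assignment. -/
def weight (W : List ((ℕ × ℕ) × ℕ)) (T : List (ℕ × ℕ)) : ℕ :=
  (W.map fun e => bif decide (look T e.1.1 = some e.1.2) then e.2 else 0).sum

/-- A partial assignment of minimum weight. -/
def lightest (W : List ((ℕ × ℕ) × ℕ)) (Ts : List (List (ℕ × ℕ))) : List (ℕ × ℕ) :=
  Ts.foldl (fun S T => bif decide (weight W S ≤ weight W T) then S else T) (Ts.headD [])

/-- One step of `reduce`; the state consists of the weight that is still to be removed and the
entries that have been processed. -/
def reduceStep (T : List (ℕ × ℕ)) (s : ℕ × List ((ℕ × ℕ) × ℕ)) (e : (ℕ × ℕ) × ℕ) :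
    ℕ × List ((ℕ × ℕ) × ℕ) :=
  bif decide (look T e.1.1 = some e.1.2) then (s.1 - e.2, (e.1, e.2 - s.1) :: s.2)
  else (s.1, e :: s.2)

/-- Remove weight `m`, or everything if there is less, from the pairs of `T`. -/
def reduce (m : ℕ) (W : List ((ℕ × ℕ) × ℕ)) (T : List (ℕ × ℕ)) : List ((ℕ × ℕ) × ℕ) :=
  (W.foldl (reduceStep T) (m, [])).2

/-- If `v` is free, extend the partial assignment by a lightest extension to `v`, and reduce the
weights of all extensions by its weight. -/
def assignStep (cs : List (List (List (ℕ × ℕ)))) (vars labels : List ℕ)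
    (s : List (ℕ × ℕ) × List ((ℕ × ℕ) × ℕ)) (v : ℕ) : List (ℕ × ℕ) × List ((ℕ × ℕ) × ℕ) :=
  bif (look s.1 v).isNone && !(extensions cs vars labels s.1 v).isEmpty then
    (lightest s.2 (extensions cs vars labels s.1 v),
      (extensions cs vars labels s.1 v).foldl
        (reduce (weight s.2 (lightest s.2 (extensions cs vars labels s.1 v)))) s.2)
  else s

/-- Find a satisfying assignment of small weight. -/
def assign (cs : List (List (List (ℕ × ℕ)))) (vars labels : List ℕ) (W : List ((ℕ × ℕ) × ℕ)) :
    List (ℕ × ℕ) :=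
  (vars.foldl (assignStep cs vars labels) ([], W)).1

/-! ### Running time of the algorithm. -/

section
variable {α β γ σ : Type} [Enc α] [Enc β] [Enc γ] [Enc σ]

@[fun_prop]
theorem pt_compat {T u : γ → List (ℕ × ℕ)} (hT : PT T) (hu : PT u) :
    PT fun c => compat (T c) (u c) := by
  have hT' : PT fun x : γ × ℕ × ℕ => T x.1 := hT.comp (by fun_prop)
  exact PT.all (p := fun c p => (look (T c) p.1).isNone || decide (look (T c) p.1 = some p.2))
    (by fun_prop) hu

@[fun_prop]
theorem pt_addForced {L : γ → List (List (ℕ × ℕ))} {T : γ → List (ℕ × ℕ)} {p : γ → ℕ × ℕ}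
    (hL : PT L) (hT : PT T) (hp : PT p) : PT fun c => addForced (L c) (T c) (p c) := by
  have hp' : PT fun x : γ × List (ℕ × ℕ) => p x.1 := hp.comp (by fun_prop)
  have hp'' : PT fun x : (γ × List (ℕ × ℕ)) × ℕ × ℕ => p x.1.1 := hp.comp (by fun_prop)
  have h := PT.all (p := fun c u => u.any fun q => decide (p c = q))
    (PT.any (p := fun x : γ × List (ℕ × ℕ) => fun q => decide (p x.1 = q)) (by fun_prop)
      (by fun_prop)) hL
  unfold addForced
  fun_prop

theorem esize_addForced_le (L : List (List (ℕ × ℕ))) (T : List (ℕ × ℕ)) (p : ℕ × ℕ) :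
    esize (addForced L T p) ≤ esize T + (esize p + 1) := by
  unfold addForced
  cases (look T p.1).isNone && L.all (fun u => u.any fun q => decide (p = q))
  · simp
  · simp only [cond_true, esize_cons]; omega

/-- Forced pairs lie in every compatible tuple, so only the pairs of the first one are candidates,
and this tuple is part of `C`. The growth is thus additive. -/
theorem esize_propagate_le (T : List (ℕ × ℕ)) (C : List (List (ℕ × ℕ))) :
    esize (propagate T C) ≤ esize T + esize C := by
  have h : ∀ (l : List (ℕ × ℕ)) (L) (T), esize (l.foldl (addForced L) T) ≤ esize T + esize l := by
    intro l L
    induction l with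
    | nil => intro T; simp
    | cons p l ih =>
      intro T
      have h1 := ih (addForced L T p)
      have h2 := esize_addForced_le L T p
      rw [List.foldl_cons, esize_cons]
      omega
  refine (h _ _ _).trans (Nat.add_le_add_left ?_ _)
  cases hL : C.filter (compat T) with
  | nil => exact esize_pos C
  | cons u L =>
    refine esize_le_of_mem (List.mem_of_mem_filter (p := compat T) ?_)
    simp [hL]

@[fun_prop]
theorem pt_propagate {T : γ → List (ℕ × ℕ)} {C : γ → List (List (ℕ × ℕ))}
    (hT : PT T) (hC : PT C) : PT fun c => propagate (T c) (C c) := by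
  have hT' : PT fun x : γ × List (ℕ × ℕ) => T x.1 := hT.comp (by fun_prop)
  have h := PT.filter (p := fun c u => compat (T c) u) (by fun_prop) hC
  refine PT.foldl (f := fun c T' p => addForced ((C c).filter (compat (T c))) T' p) ?_ hT
    (by fun_prop) (g := fun _ p => esize p + 1) ((PB.comp .esize .snd).add (.const 1))
    fun c T' p => esize_addForced_le _ _ _
  have h' : PT fun x : γ × List (ℕ × ℕ) × ℕ × ℕ => (C x.1).filter (compat (T x.1)) :=
    h.comp (by fun_prop)
  fun_prop

theorem esize_foldl_propagate_le (cs : List (List (List (ℕ × ℕ)))) (T : List (ℕ × ℕ)) :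
    esize (cs.foldl propagate T) ≤ esize T + esize cs := by
  induction cs generalizing T with
  | nil => simp
  | cons C cs ih =>
    have h1 := ih (propagate T C)
    have h2 := esize_propagate_le T C
    rw [List.foldl_cons, esize_cons]
    omega

theorem esize_closure_le (cs : List (List (List (ℕ × ℕ)))) (vars : List ℕ) (T : List (ℕ × ℕ)) :
    esize (closure cs vars T) ≤ esize T + vars.length * esize cs := by
  unfold closure
  induction vars generalizing T with
  | nil => simp
  | cons v vars ih =>
    have h1 := ih (cs.foldl propagate T)
    have h2 := esize_foldl_propagate_le cs T
    rw [List.foldl_cons, List.length_cons, add_mul]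
    omega

@[fun_prop]
theorem pt_closure {cs : γ → List (List (List (ℕ × ℕ)))} {vars : γ → List ℕ}
    {T : γ → List (ℕ × ℕ)} (hcs : PT cs) (hv : PT vars) (hT : PT T) :
    PT fun c => closure (cs c) (vars c) (T c) := by
  have h : PT fun x : List (ℕ × ℕ) × List (List (List (ℕ × ℕ))) => x.2.foldl propagate x.1 :=
    PT.foldl (f := fun _ T C => propagate T C) (by fun_prop) (by fun_prop) (by fun_prop)
      (g := fun _ C => esize C) (PB.comp .esize .snd) fun c T C => esize_propagate_le _ _
  refine PT.foldl (f := fun c T _ => (cs c).foldl propagate T) ?_ hT hv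
    (g := fun c _ => esize (cs c)) (hcs.comp .fst).pb
    fun c T _ => esize_foldl_propagate_le _ _
  have hcs' : PT fun x : γ × List (ℕ × ℕ) × ℕ => cs x.1 := hcs.comp (by fun_prop)
  exact h.comp (g := fun x : γ × List (ℕ × ℕ) × ℕ => (x.2.1, cs x.1)) (by fun_prop)

@[fun_prop]
theorem pt_consistent {cs : γ → List (List (List (ℕ × ℕ)))} {T : γ → List (ℕ × ℕ)}
    (hcs : PT cs) (hT : PT T) : PT fun c => consistent (cs c) (T c) := by
  have hT' : PT fun x : (γ × List (List (ℕ × ℕ))) × List (ℕ × ℕ) => T x.1.1 :=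
    hT.comp (by fun_prop)
  refine PT.all (p := fun c C => C.any (compat (T c))) ?_ hcs
  exact PT.any (p := fun (x : γ × List (List (ℕ × ℕ))) u => compat (T x.1) u) (by fun_prop) (by fun_prop)

@[fun_prop]
theorem pt_extensions {cs : γ → List (List (List (ℕ × ℕ)))} {vars labels : γ → List ℕ}
    {P : γ → List (ℕ × ℕ)} {v : γ → ℕ} (hcs : PT cs) (hvars : PT vars) (hl : PT labels) (hP : PT P)
    (hv : PT v) : PT fun c => extensions (cs c) (vars c) (labels c) (P c) (v c) := by
  refine PT.filter (p := fun c T => consistent (cs c) T) ?_ (PT.map ?_ hl)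
  · have hcs' : PT fun x : γ × List (ℕ × ℕ) => cs x.1 := hcs.comp (by fun_prop)
    fun_prop
  · have h1 : PT fun x : γ × ℕ => cs x.1 := hcs.comp (by fun_prop)
    have h2 : PT fun x : γ × ℕ => vars x.1 := hvars.comp (by fun_prop)
    have h3 : PT fun x : γ × ℕ => P x.1 := hP.comp (by fun_prop)
    have h4 : PT fun x : γ × ℕ => v x.1 := hv.comp (by fun_prop)
    fun_prop

theorem esize_extensions_le {cs : List (List (List (ℕ × ℕ)))} {vars labels : List ℕ}
    {P T : List (ℕ × ℕ)} {v : ℕ} (h : T ∈ extensions cs vars labels P v) :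
    esize T ≤ esize P + (esize v + esize labels + 2 + vars.length * esize cs) := by
  obtain ⟨a, ha, rfl⟩ := List.mem_map.1 (List.mem_of_mem_filter h)
  have h1 := esize_closure_le cs vars ((v, a) :: P)
  have h2 := esize_le_of_mem ha
  rw [esize_cons, esize_pair] at h1
  omega

@[fun_prop]
theorem pt_weight {W : γ → List ((ℕ × ℕ) × ℕ)} {T : γ → List (ℕ × ℕ)} (hW : PT W) (hT : PT T) :
    PT fun c => weight (W c) (T c) := by
  have hT' : PT fun x : γ × (ℕ × ℕ) × ℕ => T x.1 := hT.comp (by fun_prop)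
  exact PT.sum_map (f := fun c (e : (ℕ × ℕ) × ℕ) =>
    bif decide (look (T c) e.1.1 = some e.1.2) then e.2 else 0) (by fun_prop) hW

@[fun_prop]
theorem pt_lightest {W : γ → List ((ℕ × ℕ) × ℕ)} {Ts : γ → List (List (ℕ × ℕ))}
    (hW : PT W) (hT : PT Ts) : PT fun c => lightest (W c) (Ts c) := by
  have hW' : PT fun x : γ × List (ℕ × ℕ) × List (ℕ × ℕ) => W x.1 := hW.comp (by fun_prop)
  refine PT.foldl (f := fun c S T => bif decide (weight (W c) S ≤ weight (W c) T) then S else T)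
    (by fun_prop) (by fun_prop) hT (g := fun _ T => esize T) (PB.comp .esize .snd) fun c S T => ?_
  cases decide (weight (W c) S ≤ weight (W c) T) <;> simp

@[fun_prop]
theorem pt_reduceStep {T : γ → List (ℕ × ℕ)} {s : γ → ℕ × List ((ℕ × ℕ) × ℕ)}
    {e : γ → (ℕ × ℕ) × ℕ} (hT : PT T) (hs : PT s) (he : PT e) :
    PT fun c => reduceStep (T c) (s c) (e c) := by
  unfold reduceStep
  fun_prop

/-- A bound for the size of a weight table that does not increase when weights decrease. -/
def tableSize (W : List ((ℕ × ℕ) × ℕ)) : ℕ := (W.map fun e => esize e.1 + 4 * e.2.size + 3).sum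

theorem tableSize_cons (e : (ℕ × ℕ) × ℕ) (W : List ((ℕ × ℕ) × ℕ)) :
    tableSize (e :: W) = esize e.1 + 4 * e.2.size + 3 + tableSize W := by simp [tableSize]

theorem esize_le_tableSize (W : List ((ℕ × ℕ) × ℕ)) : esize W ≤ tableSize W + 1 := by
  induction W with
  | nil => simp [esize_nil]
  | cons e W ih =>
    obtain ⟨k, w⟩ := e
    have := esize_le_size w
    rw [tableSize_cons, esize_cons, esize_pair k w]
    dsimp only
    omega

theorem tableSize_le_esize (W : List ((ℕ × ℕ) × ℕ)) : tableSize W ≤ 4 * esize W := by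
  induction W with
  | nil => simp [tableSize]
  | cons e W ih =>
    obtain ⟨k, w⟩ := e
    have := size_le_esize w
    rw [tableSize_cons, esize_cons, esize_pair k w]
    dsimp only
    omega

theorem tableSize_reduceStep_le (T : List (ℕ × ℕ)) (s : ℕ × List ((ℕ × ℕ) × ℕ))
    (e : (ℕ × ℕ) × ℕ) : tableSize (reduceStep T s e).2 ≤
      tableSize s.2 + (esize e.1 + 4 * e.2.size + 3) := by
  unfold reduceStep
  have h2 : (e.2 - s.1).size ≤ e.2.size := Nat.size_le_size (Nat.sub_le _ _)
  cases decide (look T e.1.1 = some e.1.2) <;>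
    simp only [cond_true, cond_false, tableSize_cons] <;> omega

/-- `esize` itself would not do: a bit `true` is a larger tree than `false`, so `7` has a larger
encoding than `8`. The bit length in `tableSize` is monotone. -/
theorem tableSize_reduce_le (m : ℕ) (W : List ((ℕ × ℕ) × ℕ)) (T : List (ℕ × ℕ)) :
    tableSize (reduce m W T) ≤ tableSize W := by
  have h : ∀ s, tableSize (W.foldl (reduceStep T) s).2 ≤ tableSize s.2 + tableSize W := by
    induction W with
    | nil => simp
    | cons e W ih =>
      intro s
      have h1 := ih (reduceStep T s e)
      have h2 := tableSize_reduceStep_le T s e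
      rw [List.foldl_cons, tableSize_cons]
      omega
  exact (h (m, [])).trans (by simp [tableSize])

@[fun_prop]
theorem pt_reduce {m : γ → ℕ} {T : γ → List (ℕ × ℕ)} {W : γ → List ((ℕ × ℕ) × ℕ)}
    (hm : PT m) (hW : PT W) (hT : PT T) : PT fun c => reduce (m c) (W c) (T c) := by
  have hT' : PT fun x : γ × (ℕ × List ((ℕ × ℕ) × ℕ)) × (ℕ × ℕ) × ℕ => T x.1 :=
    hT.comp (by fun_prop)
  refine PT.snd.comp (PT.foldl_of_measure (f := fun c s e => reduceStep (T c) s e)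
    (by fun_prop) (by fun_prop) hW
    (fun s => 4 * s.1.size + tableSize s.2 + 3) 10 (fun s => ?_) (fun s => ?_)
    (g := fun _ e => 4 * esize e) ((PB.const 4).mul (PB.comp .esize .snd)) fun c s e => ?_)
  · have h1 := esize_le_size s.1
    have h2 := esize_le_tableSize s.2
    have h3 : esize s = _ := esize_pair s.1 s.2
    omega
  · have h1 := size_le_esize s.1
    have h2 := tableSize_le_esize s.2
    have h3 : esize s = _ := esize_pair s.1 s.2
    omega
  · have h1 := tableSize_reduceStep_le (T c) s e
    have h2 : esize e = _ := esize_pair e.1 e.2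
    have h3 := size_le_esize e.2
    have h4 : (reduceStep (T c) s e).1.size ≤ s.1.size := by
      unfold reduceStep
      cases decide (look (T c) e.1.1 = some e.1.2)
      · rfl
      · exact Nat.size_le_size (Nat.sub_le _ _)
    omega

theorem tableSize_foldl_reduce_le (m : ℕ) (Ts : List (List (ℕ × ℕ))) (W : List ((ℕ × ℕ) × ℕ)) :
    tableSize (Ts.foldl (reduce m) W) ≤ tableSize W := by
  induction Ts generalizing W with
  | nil => simp
  | cons T Ts ih => exact (ih _).trans (tableSize_reduce_le m W T)

@[fun_prop]
theorem pt_foldl_reduce {m : γ → ℕ} {Ts : γ → List (List (ℕ × ℕ))} {W : γ → List ((ℕ × ℕ) × ℕ)}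
    (hm : PT m) (hT : PT Ts) (hW : PT W) : PT fun c => (Ts c).foldl (reduce (m c)) (W c) := by
  have hm' : PT fun x : γ × List ((ℕ × ℕ) × ℕ) × List (ℕ × ℕ) => m x.1 := hm.comp (by fun_prop)
  refine PT.foldl_of_measure (f := fun c W T => reduce (m c) W T) (by fun_prop) hW hT
    tableSize 4 (fun s => ?_) (fun s => ?_) (g := fun _ _ => 0) (.const 0) fun c W T => ?_
  · have := esize_le_tableSize s
    omega
  · have := tableSize_le_esize s
    omega
  · exact tableSize_reduce_le _ _ _

theorem lightest_mem {W : List ((ℕ × ℕ) × ℕ)} {Ts : List (List (ℕ × ℕ))} (h : Ts ≠ []) :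
    lightest W Ts ∈ Ts := by
  have key : ∀ (l : List (List (ℕ × ℕ))) S, l.foldl (fun S T =>
      bif decide (weight W S ≤ weight W T) then S else T) S ∈ S :: l := by
    intro l
    induction l with
    | nil => simp
    | cons T l ih =>
      intro S
      have := ih (bif decide (weight W S ≤ weight W T) then S else T)
      rw [List.foldl_cons]
      cases hd : decide (weight W S ≤ weight W T) <;> rw [hd] at this <;>
        simp only [cond_true, cond_false, List.mem_cons] at this ⊢ <;> tauto
  unfold lightest
  rcases Ts with _ | ⟨T, Ts⟩
  · exact absurd rfl h
  · have := key (T :: Ts) T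
    simp only [List.headD_cons, List.mem_cons] at this ⊢
    tauto

@[fun_prop]
theorem pt_assignStep {cs : γ → List (List (List (ℕ × ℕ)))} {vars labels : γ → List ℕ}
    {s : γ → List (ℕ × ℕ) × List ((ℕ × ℕ) × ℕ)} {v : γ → ℕ} (hcs : PT cs) (hvars : PT vars)
    (hl : PT labels) (hs : PT s) (hv : PT v) :
    PT fun c => assignStep (cs c) (vars c) (labels c) (s c) (v c) := by
  unfold assignStep
  fun_prop

@[fun_prop]
theorem pt_assign {cs : γ → List (List (List (ℕ × ℕ)))} {vars labels : γ → List ℕ}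
    {W : γ → List ((ℕ × ℕ) × ℕ)} (hcs : PT cs) (hvars : PT vars)
    (hl : PT labels) (hW : PT W) : PT fun c => assign (cs c) (vars c) (labels c) (W c) := by
  -- The weights never contribute to the growth, and one round enlarges the partial assignment by an
  -- amount that does not depend on the current state.
  refine PT.fst.comp (PT.foldl_of_measure (f := fun c s v =>
    assignStep (cs c) (vars c) (labels c) s v) ?_ (by fun_prop) hvars
    (fun s => esize s.1 + tableSize s.2 + 2) 4 (fun s => ?_) (fun s => ?_)
    (g := fun c v => esize v + esize (labels c) + 2 + esize (vars c) * esize (cs c)) ?_ ?_)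
  · have h1 : PT fun x : γ × (List (ℕ × ℕ) × List ((ℕ × ℕ) × ℕ)) × ℕ => cs x.1 :=
      hcs.comp (by fun_prop)
    have h2 : PT fun x : γ × (List (ℕ × ℕ) × List ((ℕ × ℕ) × ℕ)) × ℕ => vars x.1 :=
      hvars.comp (by fun_prop)
    have h3 : PT fun x : γ × (List (ℕ × ℕ) × List ((ℕ × ℕ) × ℕ)) × ℕ => labels x.1 :=
      hl.comp (by fun_prop)
    fun_prop
  · have h2 := esize_le_tableSize s.2
    have h3 : esize s = _ := esize_pair s.1 s.2
    omega
  · have h2 := tableSize_le_esize s.2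
    have h3 : esize s = _ := esize_pair s.1 s.2
    omega
  · exact (((PB.comp .esize .snd).add (hl.comp .fst).pb).add (.const 2)).add
      ((hvars.comp .fst).pb.mul (hcs.comp .fst).pb)
  · intro c s v
    unfold assignStep
    by_cases h : (extensions (cs c) (vars c) (labels c) s.1 v) = []
    · simp [h]
    · cases (look s.1 v).isNone
      · simp
      · simp only [Bool.true_and, cond_true, List.isEmpty_eq_false_iff.2 h,
          Bool.not_false]
        have h1 := esize_extensions_le (lightest_mem (W := s.2) h)
        have h2 := tableSize_foldl_reduce_le
          (weight s.2 (lightest s.2 (extensions (cs c) (vars c) (labels c) s.1 v)))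
          (extensions (cs c) (vars c) (labels c) s.1 v) s.2
        have h3 : (vars c).length * esize (cs c) ≤ esize (vars c) * esize (cs c) := by
          gcongr; exact length_le_esize _
        omega

end

/-! ## Reading the instance -/

theorem encodeCost_top : encodeCost ⊤ = .nil := rfl

theorem encodeCost_coe (q : ℚ≥0) :
    encodeCost (q : WithTop ℚ≥0) = .cons (encodeNat q.num) (encodeNat q.den) := rfl

instance : Enc (WithTop ℚ≥0) where
  enc := encodeCost
  inj x y h := by
    cases x <;> cases y
    · rfl
    · simp [encodeCost_top, encodeCost_coe] at h
    · simp [encodeCost_top, encodeCost_coe] at h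
    · simp only [encodeCost_coe, Data.cons.injEq] at h
      rw [NNRat.ext_num_den (inj h.1 : _) (inj h.2 : _)]

/-- The numerator of a cost. -/
def costNum : WithTop ℚ≥0 → ℕ
  | none => 0
  | some q => q.num

/-- The denominator of a cost. -/
def costDen : WithTop ℚ≥0 → ℕ
  | none => 1
  | some q => q.den

/-- A number with which all the finite costs of a table become integers. -/
def commonDen (E : List ((ℕ × ℕ) × WithTop ℚ≥0)) : ℕ := (E.map fun e => costDen e.2).prod

/-- The product of the cost of `e` and `commonDen E`, computed without a division; it is `0` if the
cost is infinite. -/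
def scaledCost (E : List ((ℕ × ℕ) × WithTop ℚ≥0)) (e : (ℕ × ℕ) × WithTop ℚ≥0) : ℕ :=
  (E.map fun e' => bif decide (e'.1 = e.1) then costNum e'.2 else costDen e'.2).prod

open Classical in
/-- Integer weights; infinite costs become a weight that is larger than `k` times the sum of all
finite ones. -/
noncomputable def weights (k : ℕ) (E : List ((ℕ × ℕ) × WithTop ℚ≥0)) : List ((ℕ × ℕ) × ℕ) :=
  E.map fun e => (e.1, bif decide (e.2 = ⊤) then k * (E.map (scaledCost E)).sum + 1
    else scaledCost E e)

/-- The table of the costs as a list of entries. -/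
def entries (rows : List (List (WithTop ℚ≥0))) : List ((ℕ × ℕ) × WithTop ℚ≥0) :=
  rows.zipIdx.flatMap fun r => r.1.zipIdx.map fun c => ((r.2, c.2), c.1)

/-- The pairs of the elements of two lists, in reverse order. -/
def pairs (scope t : List ℕ) : List (ℕ × ℕ) :=
  (scope.foldl (fun (s : List ℕ × List (ℕ × ℕ)) x => (s.1.tail, (x, s.1.headD 0) :: s.2)) (t, [])).2

/-- The list of the tuples of a constraint; `rels` lists the tuples of the relations. -/
def constraintTuples (rels : List (ℕ × List (List ℕ))) (C : ℕ × List ℕ) : List (List (ℕ × ℕ)) :=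
  ((look rels C.1).getD []).map (pairs C.2)

/-- Collect the labels of the variables, if the assignment is total and consistent. -/
def answer (cs : List (List (List (ℕ × ℕ)))) (vars : List ℕ) (P : List (ℕ × ℕ)) :
    Option (List ℕ) :=
  bif vars.all (fun v => !(look P v).isNone) && consistent cs P then
    some (vars.map fun v => (look P v).getD 0)
  else none

/-- The whole algorithm. -/
noncomputable def solve (rels : List (ℕ × List (List ℕ))) (k : ℕ)
    (I : List (ℕ × List ℕ) × List (List (WithTop ℚ≥0))) : Option (List ℕ) :=
  answer (I.1.map (constraintTuples rels)) (I.2.zipIdx.map Prod.snd)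
    (assign (I.1.map (constraintTuples rels)) (I.2.zipIdx.map Prod.snd) (List.range k)
      (weights k (entries I.2)))

/-! ### Running time of reading the instance. -/

section
variable {α β γ σ : Type} [Enc α] [Enc β] [Enc γ] [Enc σ]

-- Each step stores a copy of the counter, so the growth depends on the accumulator and `PT.foldl`
-- does not apply. The accumulator is bounded directly: the counter never exceeds the length of the
-- list.
@[fun_prop]
theorem pt_zipIdx {l : γ → List α} (hl : PT l) : PT fun c => (l c).zipIdx := by
  have h1 : ∀ (l : List α) i (acc : List (α × ℕ)),
      l.foldl (fun s a => (s.1 + 1, (a, s.1) :: s.2)) (i, acc) =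
        (i + l.length, (l.zipIdx i).reverse ++ acc) := by
    intro l
    induction l with
    | nil => simp
    | cons a l ih => intro i acc; simp [ih]; omega
  have hn : ∀ n : ℕ, esize n ≤ 4 * n + 1 := fun n => by
    have h1 := esize_le_size n
    have h2 : n.size ≤ n := Nat.size_le.2 Nat.lt_two_pow_self
    omega
  have h2 : ∀ (l : List α) i, esize (l.zipIdx i) ≤ esize l + l.length * (4 * (i + l.length) + 3) := by
    intro l
    induction l with
    | nil => simp [esize_nil]
    | cons a l ih =>
      intro i
      have h3 := ih (i + 1)
      have h4 := hn i
      simp only [List.zipIdx_cons, esize_cons, esize_pair, List.length_cons]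
      nlinarith
  have h := PT.foldl_of_bounded (f := fun (_ : γ) (s : ℕ × List (α × ℕ)) a =>
    (s.1 + 1, (a, s.1) :: s.2)) (i := fun _ => (0, [])) (by fun_prop) (by fun_prop) hl
    (Z := fun c => esize (l c) + esize (l c) * (4 * esize (l c) + 3) + (4 * esize (l c) + 3))
    ((hl.pb.add (hl.pb.mul (((PB.const 4).mul hl.pb).add (.const 3)))).add
      (((PB.const 4).mul hl.pb).add (.const 3))) fun c l' hl' => by
      have e1 : l'.length ≤ esize (l c) := hl'.length_le.trans (length_le_esize _)
      have e2 : esize l' ≤ esize (l c) := by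
        obtain ⟨l'', h⟩ := hl'
        have := esize_append l' l''
        have := esize_pos l''
        rw [h] at *
        omega
      have e3 := h2 l' 0
      have e4 := hn l'.length
      rw [h1, esize_pair, List.append_nil, esize_reverse, zero_add]
      have e5 : l'.length * (4 * (0 + l'.length) + 3) ≤ esize (l c) * (4 * esize (l c) + 3) := by
        gcongr; omega
      omega
  exact (PT.snd.comp h).reverse.congr fun c => by simp [h1]

@[fun_prop]
theorem pt_costNum {f : γ → WithTop ℚ≥0} (hf : PT f) : PT fun c => costNum (f c) :=
  (PT.of_hd (f := costNum) fun x => by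
    cases x
    · exact enc_zero
    · rfl).comp hf

@[fun_prop]
theorem pt_costDen {f : γ → WithTop ℚ≥0} (hf : PT f) : PT fun c => costDen (f c) := by
  classical
  -- The right subtree of the code of `⊤` is the leaf, which reads as `0`; the value `1` at `⊤` is
  -- inserted afterwards.
  have h : PT (fun x : WithTop ℚ≥0 => bif decide (x = ⊤) then 0 else costDen x) :=
    PT.of_tl fun x => by
      cases x
      · exact enc_zero
      · rfl
  have h2 : PT costDen := PT.congr (f := fun x => bif decide (x = ⊤) then 1 else
    bif decide (x = ⊤) then 0 else costDen x) (by fun_prop) fun x => by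
      cases x
      · rfl
      · simp
  exact h2.comp hf

@[fun_prop]
theorem pt_scaledCost {E : γ → List ((ℕ × ℕ) × WithTop ℚ≥0)} {e : γ → (ℕ × ℕ) × WithTop ℚ≥0}
    (hE : PT E) (he : PT e) : PT fun c => scaledCost (E c) (e c) := by
  have he' : PT fun x : γ × (ℕ × ℕ) × WithTop ℚ≥0 => e x.1 := he.comp (by fun_prop)
  exact PT.prod_map (f := fun c e' => bif decide (e'.1 = (e c).1) then costNum e'.2 else
    costDen e'.2) (by fun_prop) hE

@[fun_prop]
theorem pt_weights (k : ℕ) {E : γ → List ((ℕ × ℕ) × WithTop ℚ≥0)} (hE : PT E) :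
    PT fun c => weights k (E c) := by
  classical
  have hE' : PT fun x : γ × (ℕ × ℕ) × WithTop ℚ≥0 => E x.1 := hE.comp (by fun_prop)
  have h : PT fun c => ((E c).map (scaledCost (E c))).sum := PT.sum_map (by fun_prop) hE
  have h' : PT fun x : γ × (ℕ × ℕ) × WithTop ℚ≥0 => ((E x.1).map (scaledCost (E x.1))).sum :=
    h.comp (by fun_prop)
  exact PT.map (f := fun c e => (e.1, bif decide (e.2 = ⊤) then
    k * ((E c).map (scaledCost (E c))).sum + 1 else scaledCost (E c) e)) (by fun_prop) hE

@[fun_prop]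
theorem pt_entries {R : γ → List (List (WithTop ℚ≥0))} (hR : PT R) : PT fun c => entries (R c) := by
  refine PT.flatMap (f := fun _ (r : List (WithTop ℚ≥0) × ℕ) =>
    r.1.zipIdx.map fun c => ((r.2, c.2), c.1)) (l := fun c => (R c).zipIdx) ?_ (by fun_prop)
  exact PT.map (f := fun (x : γ × List (WithTop ℚ≥0) × ℕ) (c : WithTop ℚ≥0 × ℕ) =>
    ((x.2.2, c.2), c.1)) (by fun_prop)
    (by fun_prop)

@[fun_prop]
theorem pt_pairs {s t : γ → List ℕ} (hs : PT s) (ht : PT t) : PT fun c => pairs (s c) (t c) := by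
  refine PT.snd.comp (PT.foldl (f := fun _ (s : List ℕ × List (ℕ × ℕ)) x =>
    (s.1.tail, (x, s.1.headD 0) :: s.2)) (by fun_prop) (by fun_prop) hs
    (g := fun _ x => esize x + 5) ((PB.comp .esize .snd).add (.const 5)) fun _ s x => ?_)
  obtain ⟨t, acc⟩ := s
  have h0 : esize 0 = 1 := by unfold esize; rw [enc_zero]; rfl
  cases t
  · simp [esize_pair, esize_cons, esize_nil, h0]; omega
  · simp [esize_pair, esize_cons]; omega

@[fun_prop]
theorem pt_constraintTuples (rels : List (ℕ × List (List ℕ))) {C : γ → ℕ × List ℕ} (hC : PT C) :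
    PT fun c => constraintTuples rels (C c) := by
  have hC' : PT fun x : γ × List ℕ => C x.1 := hC.comp (by fun_prop)
  exact PT.map (f := fun c t => pairs (C c).2 t) (by fun_prop) (by fun_prop)

@[fun_prop]
theorem pt_answer {cs : γ → List (List (List (ℕ × ℕ)))} {vars : γ → List ℕ}
    {P : γ → List (ℕ × ℕ)} (hcs : PT cs) (hv : PT vars) (hP : PT P) :
    PT fun c => answer (cs c) (vars c) (P c) := by
  have hP' : PT fun x : γ × ℕ => P x.1 := hP.comp (by fun_prop)
  have h1 : PT fun c => (vars c).all fun v => !(look (P c) v).isNone :=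
    PT.all (p := fun c v => !(look (P c) v).isNone) (by fun_prop) hv
  have h2 : PT fun c => (vars c).map fun v => (look (P c) v).getD 0 :=
    PT.map (f := fun c v => (look (P c) v).getD 0) (by fun_prop) hv
  unfold answer
  fun_prop

theorem pt_solve (rels : List (ℕ × List (List ℕ))) (k : ℕ) : PT (solve rels k) := by
  have h1 : PT fun I : List (ℕ × List ℕ) × List (List (WithTop ℚ≥0)) =>
      I.1.map (constraintTuples rels) := PT.map (by fun_prop) (by fun_prop)
  have h2 : PT fun I : List (ℕ × List ℕ) × List (List (WithTop ℚ≥0)) => I.2.zipIdx.map Prod.snd :=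
    PT.map (f := fun _ => Prod.snd) (by fun_prop) (by fun_prop)
  unfold solve
  fun_prop

end

/-! ## Propagation -/

/-- The assignment `A` agrees with the partial assignment `T`. -/
def Agrees (A : ℕ → ℕ) (T : List (ℕ × ℕ)) : Prop := ∀ x b, look T x = some b → A x = b

/-- The partial assignment `T'` extends `T`. -/
def Extends (T' T : List (ℕ × ℕ)) : Prop := ∀ x b, look T x = some b → look T' x = some b

/-- The assignment `A` satisfies all constraints. -/
def SatAll (cs : List (List (List (ℕ × ℕ)))) (A : ℕ → ℕ) : Prop :=
  ∀ C ∈ cs, ∃ u ∈ C, ∀ p ∈ u, A p.1 = p.2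

/-- Replace the values of `A` by those of the partial assignment `T`, where it has one. -/
def override (A : ℕ → ℕ) (T : List (ℕ × ℕ)) (x : ℕ) : ℕ := (look T x).getD (A x)

theorem agrees_override (A : ℕ → ℕ) (T : List (ℕ × ℕ)) : Agrees (override A T) T := by
  intro x b h
  simp [override, h]

theorem Extends.refl (T : List (ℕ × ℕ)) : Extends T T := fun _ _ h => h

theorem Extends.trans {T T' T'' : List (ℕ × ℕ)} (h : Extends T'' T') (h' : Extends T' T) :
    Extends T'' T := fun x b hx => h x b (h' x b hx)

theorem extends_cons {T : List (ℕ × ℕ)} {p : ℕ × ℕ} (h : look T p.1 = none) :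
    Extends (p :: T) T := by
  intro x b hx
  rw [look_cons]
  split_ifs with h'
  · rw [h', hx] at h; simp at h
  · exact hx

theorem compat_iff {T u : List (ℕ × ℕ)} :
    compat T u = true ↔ ∀ p ∈ u, look T p.1 = none ∨ look T p.1 = some p.2 := by
  simp [compat]

theorem addForced_eq_or (L : List (List (ℕ × ℕ))) (T : List (ℕ × ℕ)) (p : ℕ × ℕ) :
    (addForced L T p = p :: T ∧ look T p.1 = none ∧ ∀ u ∈ L, p ∈ u) ∨
      (addForced L T p = T ∧ (look T p.1 = none → ∃ u ∈ L, p ∉ u)) := by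
  unfold addForced
  cases h : (look T p.1).isNone && L.all fun u => u.any fun q => decide (p = q)
  · right
    refine ⟨rfl, fun h' => ?_⟩
    by_contra! hc
    simp [h'] at h
    obtain ⟨u, hu, hup⟩ := h
    exact hup (hc u hu)
  · left
    simp at h
    exact ⟨rfl, h⟩

theorem extends_foldl {ι : Type} {f : List (ℕ × ℕ) → ι → List (ℕ × ℕ)}
    (hf : ∀ T i, Extends (f T i) T) (l : List ι) (T : List (ℕ × ℕ)) : Extends (l.foldl f T) T := by
  induction l generalizing T with
  | nil => exact .refl T
  | cons i l ih => exact (ih _).trans (hf T i)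

theorem extends_propagate (T : List (ℕ × ℕ)) (C : List (List (ℕ × ℕ))) :
    Extends (propagate T C) T := by
  refine extends_foldl (fun T' p => ?_) _ T
  rcases addForced_eq_or (C.filter (compat T)) T' p with ⟨h, h', -⟩ | ⟨h, -⟩
  · rw [h]; exact extends_cons h'
  · rw [h]; exact .refl T'

theorem extends_closure (cs : List (List (List (ℕ × ℕ)))) (vars : List ℕ) (T : List (ℕ × ℕ)) :
    Extends (closure cs vars T) T :=
  extends_foldl (fun T _ => extends_foldl extends_propagate cs T) vars T

theorem compat_of_agrees {A : ℕ → ℕ} {T u : List (ℕ × ℕ)} (h : Agrees A T)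
    (hu : ∀ p ∈ u, A p.1 = p.2) : compat T u = true := by
  rw [compat_iff]
  intro p hp
  cases hl : look T p.1 with
  | none => simp
  | some b => right; rw [← h _ _ hl, hu p hp]

theorem Agrees.cons {A : ℕ → ℕ} {T : List (ℕ × ℕ)} {p : ℕ × ℕ} (h : Agrees A T)
    (hp : A p.1 = p.2) : Agrees A (p :: T) := by
  intro x b hx
  rw [look_cons] at hx
  split_ifs at hx with h'
  · rw [← h', hp]; simpa using hx
  · exact h x b hx

/-- The tuple that `A` selects is compatible with `T`. An added pair belongs to all compatible
tuples, in particular to this one. -/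
theorem Agrees.propagate {A : ℕ → ℕ} {T : List (ℕ × ℕ)} {C : List (List (ℕ × ℕ))}
    (h : Agrees A T) (hC : ∃ u ∈ C, ∀ p ∈ u, A p.1 = p.2) : Agrees A (propagate T C) := by
  obtain ⟨u, hu, hA⟩ := hC
  have hu' : u ∈ C.filter (compat T) := List.mem_filter.2 ⟨hu, compat_of_agrees h hA⟩
  unfold CSP.propagate
  generalize C.filter (compat T) = L at *
  generalize L.headD [] = l
  induction l generalizing T with
  | nil => exact h
  | cons p l ih =>
    refine ih ?_
    rcases addForced_eq_or L T p with ⟨h1, -, h2⟩ | ⟨h1, -⟩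
    · rw [h1]; exact h.cons (hA p (h2 u hu'))
    · rwa [h1]

theorem Agrees.foldl_propagate {A : ℕ → ℕ} {T : List (ℕ × ℕ)} {cs : List (List (List (ℕ × ℕ)))}
    (h : Agrees A T) (hA : SatAll cs A) : Agrees A (cs.foldl CSP.propagate T) := by
  induction cs generalizing T with
  | nil => exact h
  | cons C cs ih =>
    exact ih (h.propagate (hA C (by simp))) fun C' hC' => hA C' (by simp [hC'])

theorem Agrees.closure {A : ℕ → ℕ} {T : List (ℕ × ℕ)} {cs : List (List (List (ℕ × ℕ)))}
    (h : Agrees A T) (hA : SatAll cs A) (vars : List ℕ) : Agrees A (closure cs vars T) := by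
  unfold CSP.closure
  induction vars generalizing T with
  | nil => exact h
  | cons v vars ih => exact ih (h.foldl_propagate hA)

theorem consistent_of_agrees {A : ℕ → ℕ} {T : List (ℕ × ℕ)} {cs : List (List (List (ℕ × ℕ)))}
    (h : Agrees A T) (hA : SatAll cs A) : consistent cs T = true := by
  simp only [consistent, List.all_eq_true, List.any_eq_true]
  intro C hC
  obtain ⟨u, hu, hAu⟩ := hA C hC
  exact ⟨u, hu, compat_of_agrees h hAu⟩

/-! ### Propagation reaches a fixed point. -/

/-- Every variable has at most one label, and variables and labels are in the given ranges. -/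
def Proper (vars : List ℕ) (k : ℕ) (T : List (ℕ × ℕ)) : Prop :=
  (T.map Prod.fst).Nodup ∧ ∀ p ∈ T, p.1 ∈ vars ∧ p.2 < k

theorem look_eq_none_iff {T : List (ℕ × ℕ)} {x : ℕ} : look T x = none ↔ x ∉ T.map Prod.fst := by
  induction T with
  | nil => simp [look_nil]
  | cons p T ih =>
    rw [look_cons]
    split_ifs with h
    · simp [h]
    · rw [ih]; simp only [List.map_cons, List.mem_cons, not_or]; tauto

theorem mem_of_look_eq_some {T : List (ℕ × ℕ)} {x b : ℕ} (h : look T x = some b) : (x, b) ∈ T := by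
  induction T with
  | nil => simp [look_nil] at h
  | cons p T ih =>
    rw [look_cons] at h
    split_ifs at h with h'
    · obtain ⟨p1, p2⟩ := p
      simp at h h'
      simp [h, h']
    · exact List.mem_cons_of_mem _ (ih h)

theorem Proper.cons {vars : List ℕ} {k : ℕ} {T : List (ℕ × ℕ)} (h : Proper vars k T) {p : ℕ × ℕ}
    (hp : look T p.1 = none) (h1 : p.1 ∈ vars) (h2 : p.2 < k) : Proper vars k (p :: T) := by
  refine ⟨?_, ?_⟩
  · rw [List.map_cons, List.nodup_cons]
    exact ⟨look_eq_none_iff.1 hp, h.1⟩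
  · intro q hq
    rcases List.mem_cons.1 hq with rfl | hq
    · exact ⟨h1, h2⟩
    · exact h.2 q hq

theorem Proper.length_le {vars : List ℕ} {k : ℕ} {T : List (ℕ × ℕ)} (h : Proper vars k T) :
    T.length ≤ vars.length := by
  have h2 : T.map Prod.fst ⊆ vars := by
    intro x hx
    obtain ⟨p, hp, rfl⟩ := List.mem_map.1 hx
    exact (h.2 p hp).1
  simpa using (h.1.subperm h2).length_le

/-- All pairs that occur in a constraint are in the given ranges. -/
def InRange (vars : List ℕ) (k : ℕ) (C : List (List (ℕ × ℕ))) : Prop :=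
  ∀ u ∈ C, ∀ p ∈ u, p.1 ∈ vars ∧ p.2 < k

theorem mem_of_mem_headD {L C : List (List (ℕ × ℕ))} (hL : L ⊆ C) {p : ℕ × ℕ}
    (hp : p ∈ L.headD []) : ∃ u ∈ C, p ∈ u := by
  cases L with
  | nil => simp at hp
  | cons u L => exact ⟨u, hL (by simp), hp⟩

theorem Proper.propagate {vars : List ℕ} {k : ℕ} {T : List (ℕ × ℕ)} (h : Proper vars k T)
    {C : List (List (ℕ × ℕ))} (hC : InRange vars k C) : Proper vars k (propagate T C) := by
  have hl : ∀ p ∈ (C.filter (compat T)).headD [], p.1 ∈ vars ∧ p.2 < k := by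
    intro p hp
    obtain ⟨u, hu, hpu⟩ := mem_of_mem_headD (List.filter_subset_self C) hp
    exact hC u hu p hpu
  unfold CSP.propagate
  generalize C.filter (compat T) = L at *
  generalize L.headD [] = l at *
  induction l generalizing T with
  | nil => exact h
  | cons p l ih =>
    refine ih ?_ fun q hq => hl q (by simp [hq])
    rcases addForced_eq_or L T p with ⟨h1, h2, -⟩ | ⟨h1, -⟩
    · rw [h1]; exact h.cons h2 (hl p (by simp)).1 (hl p (by simp)).2
    · rwa [h1]

theorem Proper.foldl_propagate {vars : List ℕ} {k : ℕ} {T : List (ℕ × ℕ)} (h : Proper vars k T)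
    {cs : List (List (List (ℕ × ℕ)))} (hcs : ∀ C ∈ cs, InRange vars k C) :
    Proper vars k (cs.foldl CSP.propagate T) := by
  induction cs generalizing T with
  | nil => exact h
  | cons C cs ih =>
    exact ih (h.propagate (hcs C (by simp))) fun C' hC' => hcs C' (by simp [hC'])

theorem Proper.closure {vars : List ℕ} {k : ℕ} {T : List (ℕ × ℕ)} (h : Proper vars k T)
    {cs : List (List (List (ℕ × ℕ)))} (hcs : ∀ C ∈ cs, InRange vars k C) :
    Proper vars k (closure cs vars T) := by
  unfold CSP.closure
  suffices ∀ l : List ℕ, Proper vars k (l.foldl (fun T _ => cs.foldl CSP.propagate T) T) from this _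
  intro l
  induction l generalizing T with
  | nil => exact h
  | cons v l ih => exact ih (h.foldl_propagate hcs)

/-- If the fold does not lengthen the list, then each single step was idle. This serves both for the
pairs added within one constraint and for a round through all constraints. -/
theorem foldl_eq_self_or {ι β : Type} {f : List β → ι → List β}
    (hf : ∀ T i, f T i = T ∨ T.length < (f T i).length) (l : List ι) (T : List β) :
    (l.foldl f T = T ∧ ∀ i ∈ l, f T i = T) ∨ T.length < (l.foldl f T).length := by
  induction l generalizing T with
  | nil => left; simp
  | cons i l ih =>
    rw [List.foldl_cons]
    rcases hf T i with h | h
    · rw [h]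
      rcases ih T with ⟨h1, h2⟩ | h1
      · left
        refine ⟨h1, fun j hj => ?_⟩
        rcases List.mem_cons.1 hj with rfl | hj
        · exact h
        · exact h2 j hj
      · exact .inr h1
    · right
      rcases ih (f T i) with ⟨h1, -⟩ | h1
      · rwa [h1]
      · omega

theorem addForced_eq_self_or (L : List (List (ℕ × ℕ))) (T : List (ℕ × ℕ)) (p : ℕ × ℕ) :
    addForced L T p = T ∨ T.length < (addForced L T p).length := by
  rcases addForced_eq_or L T p with ⟨h, -⟩ | ⟨h, -⟩
  · right; simp [h]
  · exact .inl h

theorem propagate_eq_self_or (T : List (ℕ × ℕ)) (C : List (List (ℕ × ℕ))) :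
    propagate T C = T ∨ T.length < (propagate T C).length :=
  (foldl_eq_self_or (addForced_eq_self_or _) _ T).imp_left And.left

/-- A round that is not idle adds a pair, and a proper partial assignment has at most `vars.length`
pairs. Since `T` already has a pair, `vars.length` rounds are enough. -/
theorem propagate_closure {cs : List (List (List (ℕ × ℕ)))} {vars : List ℕ} {k : ℕ}
    (hcs : ∀ C ∈ cs, InRange vars k C) {T : List (ℕ × ℕ)} (hT : Proper vars k T) (h0 : T ≠ []) :
    ∀ C ∈ cs, propagate (closure cs vars T) C = closure cs vars T := by
  -- Pairs present plus rounds left exceed the maximal number of pairs, so the rounds cannot run out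
  -- before an idle one.
  have key : ∀ (l : List ℕ) T, Proper vars k T → vars.length < T.length + l.length →
      ∀ C ∈ cs, propagate (l.foldl (fun T _ => cs.foldl propagate T) T) C =
        l.foldl (fun T _ => cs.foldl propagate T) T := by
    intro l
    induction l with
    | nil =>
      intro T hT h
      have := hT.length_le
      simp at h
      omega
    | cons v l ih =>
      intro T hT h
      rcases foldl_eq_self_or propagate_eq_self_or cs T with ⟨h1, h2⟩ | h1
      · have : ∀ l : List ℕ, l.foldl (fun T _ => cs.foldl propagate T) T = T := by
          intro l
          induction l with
          | nil => rfl
          | cons v l ih => rw [List.foldl_cons, h1, ih]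
        rwa [this]
      · refine ih _ (hT.foldl_propagate hcs) ?_
        rw [List.length_cons] at h
        dsimp only
        omega
  refine key vars T hT ?_
  have := List.length_pos_iff.2 h0
  omega

/-! ### Overwriting satisfying assignments, by the dual discriminator. -/

/-- The constraint `C` applies a relation that is preserved by the dual discriminator. -/
def IsDualDiscriminatorClosed (C : List (List (ℕ × ℕ))) : Prop :=
  ∃ (n : ℕ) (scope : Fin n → ℕ) (R : Set (Fin n → ℕ)),
    (∀ t ∈ R, ∃ u ∈ C, ∀ p, p ∈ u ↔ ∃ j, p = (scope j, t j)) ∧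
    (∀ u ∈ C, ∃ t ∈ R, ∀ p, p ∈ u ↔ ∃ j, p = (scope j, t j)) ∧
    ∀ t ∈ R, ∀ u ∈ R, ∀ w ∈ R, (fun j => if u j = w j then u j else t j) ∈ R

/-- A partial assignment to which propagation along a constraint adds nothing can be combined with
every assignment that satisfies the constraint. -/
theorem IsDualDiscriminatorClosed.override {C : List (List (ℕ × ℕ))}
    (hC : IsDualDiscriminatorClosed C) {T : List (ℕ × ℕ)} (h1 : propagate T C = T)
    (h2 : C.any (compat T) = true) {A : ℕ → ℕ} (hA : ∃ u ∈ C, ∀ p ∈ u, A p.1 = p.2) :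
    ∃ u ∈ C, ∀ p ∈ u, override A T p.1 = p.2 := by
  obtain ⟨n, scope, R, hR1, hR2, hdd⟩ := hC
  have hcompat : ∀ (u : List (ℕ × ℕ)) (t : Fin n → ℕ), (∀ p, p ∈ u ↔ ∃ j, p = (scope j, t j)) → (compat T u = true ↔
      ∀ j, look T (scope j) = none ∨ look T (scope j) = some (t j)) := by
    intro u t h
    rw [compat_iff]
    constructor
    · intro h' j
      exact h' (scope j, t j) ((h _).2 ⟨j, rfl⟩)
    · intro h' p hp
      obtain ⟨j, rfl⟩ := (h p).1 hp
      exact h' j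
  let RT : Set (Fin n → ℕ) :=
    {t | t ∈ R ∧ ∀ j, look T (scope j) = none ∨ look T (scope j) = some (t j)}
  -- If all compatible tuples agreed at the free coordinate `j`, their common pair would be forced,
  -- and propagation would add it. It suffices to examine the first compatible tuple `t0`: either it
  -- differs from the given one at `j`, or its pair at `j` is missing from some other compatible
  -- tuple.
  have hother : ∀ u ∈ RT, ∀ j, look T (scope j) = none → ∃ w ∈ RT, w j ≠ u j := by
    intro t ht j hj
    obtain ⟨u0, L, hL⟩ : ∃ u0 L, C.filter (compat T) = u0 :: L := by
      apply List.exists_cons_of_ne_nil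
      obtain ⟨u, hu, huc⟩ := List.any_eq_true.1 h2
      exact List.ne_nil_of_mem (List.mem_filter.2 ⟨hu, huc⟩)
    have hmem : ∀ u ∈ C.filter (compat T), ∃ t ∈ RT, ∀ p, p ∈ u ↔ ∃ j, p = (scope j, t j) := by
      intro u hu
      obtain ⟨hu1, hu2⟩ := List.mem_filter.1 hu
      obtain ⟨t, ht, htu⟩ := hR2 u hu1
      exact ⟨t, ⟨ht, (hcompat u t htu).1 hu2⟩, htu⟩
    obtain ⟨t0, ht0, htu0⟩ := hmem u0 (by simp [hL])
    by_cases ht0j : t0 j = t j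
    · have h3 := foldl_eq_self_or (addForced_eq_self_or (C.filter (compat T)))
        ((C.filter (compat T)).headD []) T
      rcases h3 with ⟨-, h3⟩ | h3
      · have h4 := h3 (scope j, t0 j) (by rw [hL]; exact (htu0 _).2 ⟨j, rfl⟩)
        rcases addForced_eq_or (C.filter (compat T)) T (scope j, t0 j) with ⟨h5, -⟩ | ⟨-, h5⟩
        · rw [h5] at h4; simp at h4
        · obtain ⟨u, hu, hup⟩ := h5 hj
          obtain ⟨w, hw, hwu⟩ := hmem u hu
          refine ⟨w, hw, fun h6 => hup ((hwu _).2 ⟨j, ?_⟩)⟩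
          rw [h6, ht0j]
      · change _ < (propagate T C).length at h3
        rw [h1] at h3
        omega
    · exact ⟨t0, ht0, ht0j⟩
  obtain ⟨uA, huA, hAu⟩ := hA
  obtain ⟨t, ht, htu⟩ := hR2 uA huA
  have hAt : ∀ j, A (scope j) = t j := fun j => hAu _ ((htu _).2 ⟨j, rfl⟩)
  -- A compatible tuple is moved to `t` on more and more free coordinates.
  have key : ∀ J : Finset (Fin n), ∃ u ∈ RT, ∀ j ∈ J, look T (scope j) = none → u j = t j := by
    intro J
    induction J using Finset.induction_on with
    | empty =>
      obtain ⟨u, hu, huc⟩ := List.any_eq_true.1 h2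
      obtain ⟨s, hs, hsu⟩ := hR2 u hu
      exact ⟨s, ⟨hs, (hcompat u s hsu).1 huc⟩, by simp⟩
    | insert j J hj ih =>
      obtain ⟨u, hu, huJ⟩ := ih
      by_cases hl : look T (scope j) = none
      · obtain ⟨w, hw, hwj⟩ := hother u hu j hl
        -- On assigned coordinates `u` and `w` coincide, so their value survives. At `j` they
        -- differ, so `t` wins. Where `u` equals `t`, both cases give `t`.
        refine ⟨_, ⟨hdd t ht u hu.1 w hw.1, fun i => ?_⟩, fun i hi hil => ?_⟩
        · rcases hu.2 i with h | h
          · exact .inl h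
          · rcases hw.2 i with h' | h'
            · exact .inl h'
            · right
              rw [h] at h'
              rw [if_pos (by simpa using h'), h]
        · rcases Finset.mem_insert.1 hi with rfl | hi
          · simp [Ne.symm hwj]
          · simp [huJ i hi hil]
      · refine ⟨u, hu, fun i hi hil => ?_⟩
        rcases Finset.mem_insert.1 hi with rfl | hi
        · exact absurd hil hl
        · exact huJ i hi hil
  obtain ⟨s, hs, hst⟩ := key Finset.univ
  obtain ⟨u, hu, hus⟩ := hR1 s hs.1
  refine ⟨u, hu, fun p hp => ?_⟩
  obtain ⟨j, rfl⟩ := (hus p).1 hp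
  rcases hs.2 j with h | h
  · simp [CSP.override, h, hAt, hst j (by simp) h]
  · simp [CSP.override, h]


/-! ## Reducing the weights -/

open Classical in
/-- The total weight of the pairs in a set. -/
noncomputable def sumOn (W : List ((ℕ × ℕ) × ℕ)) (S : Set (ℕ × ℕ)) : ℕ :=
  (W.map fun e => if e.1 ∈ S then e.2 else 0).sum

/-- The pairs of a partial assignment. -/
def graph (T : List (ℕ × ℕ)) : Set (ℕ × ℕ) := {p | look T p.1 = some p.2}

/-- The pairs of an assignment. -/
def graphOf (A : ℕ → ℕ) : Set (ℕ × ℕ) := {p | A p.1 = p.2}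

open Classical in
theorem sumOn_cons (e : (ℕ × ℕ) × ℕ) (W : List ((ℕ × ℕ) × ℕ)) (S : Set (ℕ × ℕ)) :
    sumOn (e :: W) S = (if e.1 ∈ S then e.2 else 0) + sumOn W S := by simp [sumOn]

theorem weight_eq_sumOn (W : List ((ℕ × ℕ) × ℕ)) (T : List (ℕ × ℕ)) :
    weight W T = sumOn W (graph T) := by
  refine congrArg List.sum (List.map_congr_left fun e _ => ?_)
  by_cases h : look T e.1.1 = some e.1.2
  · rw [if_pos (show e.1 ∈ graph T from h)]; simp [h]
  · rw [if_neg (show e.1 ∉ graph T from h)]; simp [h]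

theorem sumOn_mono (W : List ((ℕ × ℕ) × ℕ)) {S S' : Set (ℕ × ℕ)} (h : S ⊆ S') :
    sumOn W S ≤ sumOn W S' := by
  classical
  induction W with
  | nil => simp [sumOn]
  | cons e W ih =>
    rw [sumOn_cons, sumOn_cons]
    have := @h e.1
    split_ifs <;> first | omega | tauto

theorem sumOn_union_le (W : List ((ℕ × ℕ) × ℕ)) (S S' : Set (ℕ × ℕ)) :
    sumOn W (S ∪ S') ≤ sumOn W S + sumOn W S' := by
  classical
  induction W with
  | nil => simp [sumOn]
  | cons e W ih =>
    simp only [sumOn_cons, Set.mem_union]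
    split_ifs <;> first | omega | tauto

theorem sumOn_empty (W : List ((ℕ × ℕ) × ℕ)) : sumOn W ∅ = 0 := by simp [sumOn]

/-- The difference of the weights `W` and `W'` is nonnegative. -/
def Lower (W' W : List ((ℕ × ℕ) × ℕ)) : Prop :=
  ∀ S S', S ⊆ S' → sumOn W' S' + sumOn W S ≤ sumOn W S' + sumOn W' S

theorem Lower.refl (W : List ((ℕ × ℕ) × ℕ)) : Lower W W := fun _ _ _ => le_rfl

theorem Lower.trans {W W' W'' : List ((ℕ × ℕ) × ℕ)} (h : Lower W'' W') (h' : Lower W' W) :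
    Lower W'' W := by
  intro S S' hS
  have h1 := h S S' hS
  have h2 := h' S S' hS
  omega

theorem Lower.sumOn_le {W W' : List ((ℕ × ℕ) × ℕ)} (h : Lower W' W) (S : Set (ℕ × ℕ)) :
    sumOn W' S ≤ sumOn W S := by
  simpa [sumOn_empty] using h ∅ S (Set.empty_subset _)

/-- No entry increases. Since `reduce` reverses the table, this is expressed by sums over nested
sets instead of entry by entry. -/
theorem lower_reduce (m : ℕ) (W : List ((ℕ × ℕ) × ℕ)) (T : List (ℕ × ℕ)) :
    Lower (reduce m W T) W := by
  classical
  intro S S' hS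
  suffices ∀ s, sumOn (W.foldl (reduceStep T) s).2 S' + sumOn s.2 S + sumOn W S ≤
      sumOn (W.foldl (reduceStep T) s).2 S + sumOn s.2 S' + sumOn W S' by
    have := this (m, [])
    simp only [sumOn, List.map_nil, List.sum_nil] at this
    unfold sumOn reduce
    omega
  induction W with
  | nil => intro s; simp [sumOn]; omega
  | cons e W ih =>
    intro s
    have h1 := ih (reduceStep T s e)
    have h2 := @hS e.1
    rw [List.foldl_cons, sumOn_cons, sumOn_cons]
    by_cases h : look T e.1.1 = some e.1.2
    · have h3 : (reduceStep T s e).2 = (e.1, e.2 - s.1) :: s.2 := by simp [reduceStep, h]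
      rw [h3, sumOn_cons, sumOn_cons] at h1
      dsimp only at h1
      split_ifs at h1 ⊢ <;> first | omega | tauto
    · have h3 : (reduceStep T s e).2 = e :: s.2 := by simp [reduceStep, h]
      rw [h3, sumOn_cons, sumOn_cons] at h1
      split_ifs at h1 ⊢ <;> omega

/-- Removal is greedy: each entry on `graph T` gives up as much as it has, until `m` has been
removed. All affected entries are counted in `S`. -/
theorem sumOn_reduce (m : ℕ) (W : List ((ℕ × ℕ) × ℕ)) (T : List (ℕ × ℕ)) {S : Set (ℕ × ℕ)}
    (hS : graph T ⊆ S) : sumOn (reduce m W T) S + min m (weight W T) = sumOn W S := by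
  classical
  rw [weight_eq_sumOn]
  suffices ∀ s, sumOn (W.foldl (reduceStep T) s).2 S + min s.1 (sumOn W (graph T)) =
      sumOn s.2 S + sumOn W S by
    have := this (m, [])
    simp only [sumOn, List.map_nil, List.sum_nil] at this
    unfold sumOn reduce
    omega
  induction W with
  | nil => intro s; simp [sumOn]
  | cons e W ih =>
    intro s
    have h1 := ih (reduceStep T s e)
    have h2 := @hS e.1
    rw [List.foldl_cons, sumOn_cons, sumOn_cons]
    by_cases h : look T e.1.1 = some e.1.2
    · have h3 : reduceStep T s e = (s.1 - e.2, (e.1, e.2 - s.1) :: s.2) := by simp [reduceStep, h]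
      have h4 : e.1 ∈ graph T := h
      rw [h3, sumOn_cons, if_pos (h2 h4)] at h1
      rw [if_pos (h2 h4), if_pos h4, h3]
      dsimp only at h1 ⊢
      omega
    · have h3 : reduceStep T s e = (s.1, e :: s.2) := by simp [reduceStep, h]
      have h4 : e.1 ∉ graph T := h
      rw [h3, sumOn_cons] at h1
      rw [if_neg h4, h3]
      dsimp only at h1 ⊢
      omega

theorem lower_foldl_reduce (m : ℕ) (Ts : List (List (ℕ × ℕ))) (W : List ((ℕ × ℕ) × ℕ)) :
    Lower (Ts.foldl (reduce m) W) W := by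
  induction Ts generalizing W with
  | nil => exact .refl W
  | cons T Ts ih => exact (ih _).trans (lower_reduce m W T)

/-- The cost side of the local ratio step: each reduction removes at most `m` in total. -/
theorem sumOn_univ_foldl_reduce (m : ℕ) (Ts : List (List (ℕ × ℕ))) (W : List ((ℕ × ℕ) × ℕ)) :
    sumOn W Set.univ ≤ sumOn (Ts.foldl (reduce m) W) Set.univ + Ts.length * m := by
  induction Ts generalizing W with
  | nil => simp
  | cons T Ts ih =>
    have h1 := ih (reduce m W T)
    have h2 := sumOn_reduce m W T (Set.subset_univ _)
    rw [List.foldl_cons, List.length_cons, add_mul]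
    omega

/-- The gain side. When the turn of `T` comes, overlapping extensions may already have used up part
of its weight, but that loss counts as well: afterwards either a further `m` is gone or nothing is
left, and `T` had at least `m` at the start. `Lower` carries the loss from `graph T` to `S`. -/
theorem sumOn_foldl_reduce {m : ℕ} {Ts : List (List (ℕ × ℕ))} {W : List ((ℕ × ℕ) × ℕ)}
    {T : List (ℕ × ℕ)} (hT : T ∈ Ts) (hm : m ≤ weight W T) {S : Set (ℕ × ℕ)} (hS : graph T ⊆ S) :
    sumOn (Ts.foldl (reduce m) W) S + m ≤ sumOn W S := by
  obtain ⟨l, l', rfl⟩ := List.append_of_mem hT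
  have h0 := lower_foldl_reduce m (l ++ T :: l') W _ _ hS
  rw [List.foldl_append, List.foldl_cons] at *
  have h1 := (lower_foldl_reduce m l W).sumOn_le (graph T)
  have h2 := sumOn_reduce m (l.foldl (reduce m) W) T (subset_refl _)
  have h3 := (lower_foldl_reduce m l' (reduce m (l.foldl (reduce m) W) T)).sumOn_le (graph T)
  rw [weight_eq_sumOn] at *
  omega

theorem weight_lightest_le {W : List ((ℕ × ℕ) × ℕ)} {Ts : List (List (ℕ × ℕ))} {T : List (ℕ × ℕ)}
    (hT : T ∈ Ts) : weight W (lightest W Ts) ≤ weight W T := by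
  have key : ∀ (l : List (List (ℕ × ℕ))) S, ∀ T ∈ S :: l, weight W (l.foldl (fun S T =>
      bif decide (weight W S ≤ weight W T) then S else T) S) ≤ weight W T := by
    intro l
    induction l with
    | nil => simp
    | cons U l ih =>
      intro S T hT
      rw [List.foldl_cons]
      by_cases hd : weight W S ≤ weight W U
      · simp only [hd, decide_true, cond_true]
        have h1 := ih S S (by simp)
        simp only [List.mem_cons] at hT
        rcases hT with rfl | rfl | hT
        · exact h1
        · exact h1.trans hd
        · exact ih S T (by simp [hT])
      · simp only [hd, decide_false, cond_false]
        have h1 := ih U U (by simp)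
        simp only [List.mem_cons] at hT
        rcases hT with rfl | rfl | hT
        · exact h1.trans (not_le.1 hd).le
        · exact h1
        · exact ih U T (by simp [hT])
  exact key _ _ _ (List.mem_cons_of_mem _ hT)

/-! ## Correctness of the algorithm -/

/-- What holds for the partial assignment and the weights while the algorithm runs. -/
structure Invariant (cs : List (List (List (ℕ × ℕ)))) (vars : List ℕ) (k : ℕ)
    (W₀ : List ((ℕ × ℕ) × ℕ)) (s : List (ℕ × ℕ) × List ((ℕ × ℕ) × ℕ)) : Prop where
  proper : Proper vars k s.1
  sat : ∀ A, SatAll cs A → SatAll cs (override A s.1)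
  weight_eq : weight s.2 s.1 = 0
  lower : Lower s.2 W₀
  -- `M` is the sum of the minima removed so far. The overwritten assignment takes the place of `A`,
  -- so that its remaining weight can be charged in the later steps.
  bound : ∃ M, sumOn W₀ Set.univ ≤ sumOn s.2 Set.univ + k * M ∧
    ∀ A, (∀ v ∈ vars, A v < k) → SatAll cs A →
      M + sumOn s.2 (graphOf (override A s.1)) ≤ sumOn W₀ (graphOf A)

section
variable {cs : List (List (List (ℕ × ℕ)))} {vars : List ℕ} {k : ℕ} {W₀ : List ((ℕ × ℕ) × ℕ)}
  {s : List (ℕ × ℕ) × List ((ℕ × ℕ) × ℕ)}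

theorem invariant_initial : Invariant cs vars k W₀ ([], W₀) where
  proper := by simp [Proper]
  sat A hA := hA
  weight_eq := by simp [weight, look_nil]
  lower := .refl _
  bound := ⟨0, by simp, fun A _ _ => (Nat.zero_add _).le⟩

theorem mem_extensions {P T : List (ℕ × ℕ)} {labels : List ℕ} {v : ℕ} :
    T ∈ extensions cs vars labels P v ↔
      (∃ a ∈ labels, closure cs vars ((v, a) :: P) = T) ∧ consistent cs T = true := by
  simp [extensions, List.mem_filter]

theorem extends_of_mem_extensions {P T : List (ℕ × ℕ)} {labels : List ℕ} {v : ℕ}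
    (h : T ∈ extensions cs vars labels P v) : ∃ a, Extends T ((v, a) :: P) := by
  obtain ⟨⟨a, -, rfl⟩, -⟩ := mem_extensions.1 h
  exact ⟨a, extends_closure cs vars _⟩

/-- A satisfying assignment gives one of the extensions. -/
theorem exists_extension {P : List (ℕ × ℕ)} {v : ℕ} (hv : v ∈ vars) (hP : look P v = none)
    (hsat : ∀ A, SatAll cs A → SatAll cs (override A P)) {A : ℕ → ℕ} (hA : ∀ v ∈ vars, A v < k)
    (hA' : SatAll cs A) :
    ∃ T ∈ extensions cs vars (List.range k) P v, Agrees (override A P) T := by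
  have h1 := ((agrees_override A P).cons (p := (v, A v)) (by simp [override, hP])).closure
    (hsat A hA') vars
  exact ⟨_, mem_extensions.2 ⟨⟨A v, List.mem_range.2 (hA v hv), rfl⟩,
    consistent_of_agrees h1 (hsat A hA')⟩, h1⟩

theorem assignStep_eq_or (labels : List ℕ) (v : ℕ) :
    (look s.1 v = none ∧ extensions cs vars labels s.1 v ≠ [] ∧
      assignStep cs vars labels s v = (lightest s.2 (extensions cs vars labels s.1 v),
        (extensions cs vars labels s.1 v).foldl
          (reduce (weight s.2 (lightest s.2 (extensions cs vars labels s.1 v)))) s.2)) ∨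
    ((look s.1 v = none → extensions cs vars labels s.1 v = []) ∧
      assignStep cs vars labels s v = s) := by
  unfold assignStep
  by_cases h1 : look s.1 v = none
  · by_cases h2 : extensions cs vars labels s.1 v = []
    · simp [h2]
    · left
      refine ⟨h1, h2, ?_⟩
      simp [h1, List.isEmpty_eq_false_iff.2 h2]
  · right
    simp [h1, Option.isNone_eq_false_iff.2 (Option.isSome_iff_ne_none.2 h1)]

/-- The local ratio step, with `M` increased by the weight of the lightest extension `T`. -/
theorem Invariant.assignStep (hs : Invariant cs vars k W₀ s)
    (hcs : ∀ C ∈ cs, InRange vars k C) (hdd : ∀ C ∈ cs, IsDualDiscriminatorClosed C) {v : ℕ}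
    (hv : v ∈ vars) : Invariant cs vars k W₀ (assignStep cs vars (List.range k) s v) := by
  rcases assignStep_eq_or (cs := cs) (vars := vars) (s := s) (List.range k) v with
    ⟨hfree, hne, heq⟩ | ⟨-, heq⟩
  swap
  · rwa [heq]
  rw [heq]
  obtain ⟨P, W⟩ := s
  dsimp only at *
  have hE : ∀ T ∈ extensions cs vars (List.range k) P v, ∃ a, Extends T ((v, a) :: P) :=
    fun T hT => extends_of_mem_extensions hT
  have hE' := lightest_mem (W := W) hne
  set E := extensions cs vars (List.range k) P v with hEdef
  set T := lightest W E with hTdef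
  obtain ⟨⟨a, ha, haT⟩, hTc⟩ := mem_extensions.1 hE'
  have hproper : Proper vars k ((v, a) :: P) := hs.proper.cons hfree hv (List.mem_range.1 ha)
  have hmin : ∀ T' ∈ E, weight W T ≤ weight W T' := fun T' hT' => weight_lightest_le hT'
  have hTP : Extends T P := by
    obtain ⟨b, hb⟩ := hE T hE'
    exact hb.trans (extends_cons (p := (v, b)) hfree)
  -- The amount removed from `T` is its whole weight.
  have hzero : sumOn (E.foldl (reduce (weight W T)) W) (graph T) = 0 := by
    have h1 := sumOn_foldl_reduce hE' le_rfl (subset_refl (graph T)) (W := W)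
    rw [← weight_eq_sumOn W] at h1
    omega
  refine ⟨?_, ?_, ?_, (lower_foldl_reduce _ _ _).trans hs.lower, ?_⟩
  · rw [← haT]
    exact hproper.closure hcs
  · intro A hA C hC
    refine (hdd C hC).override ?_ ?_ (hA C hC)
    · have := propagate_closure hcs hproper (by simp) C hC
      rwa [haT] at this
    · simp only [consistent, List.all_eq_true] at hTc
      exact hTc C hC
  · rw [weight_eq_sumOn, hzero]
  · obtain ⟨M, h1, h2⟩ := hs.bound
    refine ⟨M + weight W T, ?_, fun A hA hA' => ?_⟩
    · have h3 := sumOn_univ_foldl_reduce (weight W T) E W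
      have h4 : E.length ≤ k := by
        refine (List.length_filter_le _ _).trans ?_
        simp
      have h5 := Nat.mul_le_mul_right (weight W T) h4
      dsimp only at h1
      rw [mul_add]
      dsimp only
      omega
    · have h3 := h2 A hA hA'
      -- `T'` is the extension contained in `A` overwritten by `P`; it need not be the chosen one,
      -- but it is at least as heavy.
      obtain ⟨T', hT', hAT'⟩ := exists_extension hv hfree hs.sat hA hA'
      have h4 := sumOn_foldl_reduce hT' (hmin T' hT') (S := graphOf (override A P))
        fun p hp => hAT' _ _ hp
      -- Passing from `P` to `T` only introduces pairs of `T`, which are weightless by now.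
      have h5 : graphOf (override A T) ⊆ graph T ∪ graphOf (override A P) := by
        intro p hp
        cases hl : look T p.1 with
        | some b =>
          left
          have : b = p.2 := by simpa [graphOf, override, hl] using hp
          rw [graph, Set.mem_ofPred_eq, hl, this]
        | none =>
          right
          have h6 : look P p.1 = none := by
            by_contra h6
            obtain ⟨b, hb⟩ := Option.ne_none_iff_exists'.1 h6
            rw [hTP _ _ hb] at hl
            simp at hl
          have : A p.1 = p.2 := by simpa [graphOf, override, hl] using hp
          simpa [graphOf, override, h6] using this
      have h6 := sumOn_mono (E.foldl (reduce (weight W T)) W) h5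
      have h7 := sumOn_union_le (E.foldl (reduce (weight W T)) W) (graph T)
        (graphOf (override A P))
      rw [← hEdef] at h4
      dsimp only at h3 ⊢
      omega

theorem extends_assignStep (labels : List ℕ) (v : ℕ) :
    Extends (assignStep cs vars labels s v).1 s.1 := by
  rcases assignStep_eq_or (cs := cs) (vars := vars) (s := s) labels v with
    ⟨hfree, hne, heq⟩ | ⟨-, heq⟩
  · obtain ⟨a, ha⟩ := extends_of_mem_extensions (lightest_mem (W := s.2) hne)
    rw [heq]
    exact ha.trans (extends_cons (p := (v, a)) hfree)
  · rw [heq]; exact .refl _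

theorem Invariant.foldl_assignStep (hs : Invariant cs vars k W₀ s)
    (hcs : ∀ C ∈ cs, InRange vars k C) (hdd : ∀ C ∈ cs, IsDualDiscriminatorClosed C) {l : List ℕ}
    (hl : l ⊆ vars) : Invariant cs vars k W₀ (l.foldl (CSP.assignStep cs vars (List.range k)) s) := by
  induction l generalizing s with
  | nil => exact hs
  | cons v l ih =>
    exact ih (hs.assignStep hcs hdd (hl (by simp))) fun x hx => hl (by simp [hx])

theorem extends_foldl_assignStep (labels l : List ℕ) :
    Extends (l.foldl (assignStep cs vars labels) s).1 s.1 := by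
  induction l generalizing s with
  | nil => exact .refl _
  | cons v l ih => exact ih.trans (extends_assignStep labels v)

/-- On a satisfiable instance a free variable always has an extension, so its turn assigns it, and
later steps only extend. -/
theorem Invariant.look_ne_none (hs : Invariant cs vars k W₀ s)
    (hcs : ∀ C ∈ cs, InRange vars k C) (hdd : ∀ C ∈ cs, IsDualDiscriminatorClosed C) {l : List ℕ}
    (hl : l ⊆ vars) {A : ℕ → ℕ} (hA : ∀ v ∈ vars, A v < k) (hA' : SatAll cs A) :
    ∀ v ∈ l, look (l.foldl (CSP.assignStep cs vars (List.range k)) s).1 v ≠ none := by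
  induction l generalizing s with
  | nil => simp
  | cons v l ih =>
    intro x hx
    rcases List.mem_cons.1 hx with rfl | hx
    · have h1 : look (CSP.assignStep cs vars (List.range k) s x).1 x ≠ none := by
        rcases assignStep_eq_or (cs := cs) (vars := vars) (s := s) (List.range k) x with
          ⟨hfree, hne, heq⟩ | ⟨h, heq⟩
        · obtain ⟨a, ha⟩ := extends_of_mem_extensions (lightest_mem (W := s.2) hne)
          rw [heq]
          have := ha x a (by simp [look_cons])
          simp [this]
        · rw [heq]
          intro h0
          obtain ⟨T, hT, -⟩ := exists_extension (hl (by simp)) h0 hs.sat hA hA'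
          rw [h h0] at hT
          simp at hT
      obtain ⟨b, hb⟩ := Option.ne_none_iff_exists'.1 h1
      have := extends_foldl_assignStep (cs := cs) (vars := vars) (List.range k) l x b hb
      rw [List.foldl_cons]
      simp [this]
    · exact ih (hs.assignStep hcs hdd (hl (by simp))) (fun y hy => hl (by simp [hy])) x hx

/-- If there is no answer, there is no satisfying assignment. -/
theorem answer_assign_ne_none (hcs : ∀ C ∈ cs, InRange vars k C)
    (hdd : ∀ C ∈ cs, IsDualDiscriminatorClosed C) {A : ℕ → ℕ} (hA : ∀ v ∈ vars, A v < k)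
    (hA' : SatAll cs A) :
    answer cs vars (assign cs vars (List.range k) W₀) ≠ none := by
  have h1 := invariant_initial.look_ne_none (W₀ := W₀) hcs hdd (List.Subset.refl vars) hA hA'
  have h2 := invariant_initial.foldl_assignStep (W₀ := W₀) hcs hdd (List.Subset.refl vars)
  have h3 := consistent_of_agrees (agrees_override _ _) (h2.sat A hA')
  have h4 : (vars.all fun v => !(look (assign cs vars (List.range k) W₀) v).isNone) = true := by
    rw [List.all_eq_true]
    intro v hv
    rw [Bool.not_eq_true', Option.isNone_eq_false_iff, Option.isSome_iff_ne_none]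
    exact h1 v hv
  have h5 : consistent cs (assign cs vars (List.range k) W₀) = true := h3
  unfold answer
  rw [h4, h5]
  simp

/-- An answer is a satisfying assignment, whose weight is at most `k` times the minimum. -/
theorem answer_assign_eq_some (hcs : ∀ C ∈ cs, InRange vars k C)
    (hdd : ∀ C ∈ cs, IsDualDiscriminatorClosed C) {l : List ℕ}
    (h : answer cs vars (assign cs vars (List.range k) W₀) = some l) :
    ∃ B : ℕ → ℕ, l = vars.map B ∧ (∀ v ∈ vars, B v < k) ∧ SatAll cs B ∧
      ∀ A : ℕ → ℕ, (∀ v ∈ vars, A v < k) → SatAll cs A → (∀ e ∈ W₀, e.1.1 ∈ vars) →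
        sumOn W₀ (graphOf B) ≤ k * sumOn W₀ (graphOf A) := by
  have hinv := invariant_initial.foldl_assignStep (W₀ := W₀) hcs hdd (List.Subset.refl vars)
  set s := vars.foldl (CSP.assignStep cs vars (List.range k)) ([], W₀)
  change answer cs vars s.1 = some l at h
  unfold answer at h
  cases hc : vars.all (fun v => !(look s.1 v).isNone) && consistent cs s.1 with
  | false => rw [hc] at h; simp at h
  | true =>
    rw [hc] at h
    simp only [Bool.and_eq_true, List.all_eq_true, Bool.not_eq_true', Option.isNone_eq_false_iff,
      Option.isSome_iff_exists] at hc
    obtain ⟨hc1, hc2⟩ := hc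
    refine ⟨fun v => (look s.1 v).getD 0, ?_, fun v hv => ?_, fun C hC => ?_, ?_⟩
    · simpa using h.symm
    · obtain ⟨b, hb⟩ := hc1 v hv
      simpa [hb] using (hinv.proper.2 _ (mem_of_look_eq_some hb)).2
    · simp only [consistent, List.all_eq_true, List.any_eq_true] at hc2
      obtain ⟨u, hu, huc⟩ := hc2 C hC
      refine ⟨u, hu, fun p hp => ?_⟩
      -- All variables are assigned, so a compatible tuple is met exactly. Soundness thus rests on
      -- the final test in `answer`.
      obtain ⟨b, hb⟩ := hc1 p.1 (hcs C hC u hu p hp).1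
      rcases compat_iff.1 huc p hp with h' | h'
      · rw [h'] at hb; simp at hb
      · simp [h']
    · intro A hA hA' hW
      obtain ⟨M, h1, h2⟩ := hinv.bound
      have h3 := h2 A hA hA'
      -- The weight removed on the final partial assignment is at most the weight removed overall,
      -- hence at most `k * M`; none remains on it by `h5`.
      have h4 := hinv.lower (graph s.1) Set.univ (Set.subset_univ _)
      have h5 := hinv.weight_eq
      rw [weight_eq_sumOn] at h5
      have h6 : sumOn W₀ (graphOf fun v => (look s.1 v).getD 0) = sumOn W₀ (graph s.1) := by
        classical
        unfold sumOn
        congr 1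
        refine List.map_congr_left fun e he => ?_
        obtain ⟨b, hb⟩ := hc1 e.1.1 (hW e he)
        simp [graphOf, graph, hb]
      rw [h6]
      have h7 : k * M ≤ k * sumOn W₀ (graphOf A) := by gcongr; omega
      omega

end


/-! ## Instances -/

theorem pairs_eq {scope t : List ℕ} (h : scope.length = t.length) :
    pairs scope t = (scope.zip t).reverse := by
  suffices ∀ acc, (scope.foldl (fun (s : List ℕ × List (ℕ × ℕ)) x =>
      (s.1.tail, (x, s.1.headD 0) :: s.2)) (t, acc)).2 = (scope.zip t).reverse ++ acc by
    exact (this []).trans (List.append_nil _)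
  induction scope generalizing t with
  | nil => simp
  | cons x scope ih =>
    intro acc
    cases t with
    | nil => simp at h
    | cons b t =>
      simp only [List.length_cons, Nat.add_right_cancel_iff] at h
      simpa using ih h ((x, b) :: acc)

theorem mem_pairs_ofFn {n : ℕ} (scope t : Fin n → ℕ) (p : ℕ × ℕ) :
    p ∈ pairs (List.ofFn scope) (List.ofFn t) ↔ ∃ j, p = (scope j, t j) := by
  rw [pairs_eq (by simp), List.mem_reverse]
  have : (List.ofFn scope).zip (List.ofFn t) = List.ofFn fun j => (scope j, t j) := by
    apply List.ext_getElem <;> simp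
  rw [this, List.mem_ofFn]
  simp [eq_comm]

theorem look_map {ι β : Type} {g : ι → ℕ} (hg : Function.Injective g) (h : ι → β) {l : List ι}
    {i : ι} (hi : i ∈ l) : look (l.map fun i => (g i, h i)) (g i) = some (h i) := by
  induction l with
  | nil => simp at hi
  | cons j l ih =>
    rw [List.map_cons, look_cons]
    by_cases hj : j = i
    · simp [hj]
    · rw [if_neg fun h' => hj (hg h')]
      exact ih (by simpa [Ne.symm hj] using hi)

theorem zipIdx_ofFn {α : Type*} {n : ℕ} (f : Fin n → α) :
    (List.ofFn f).zipIdx = (List.finRange n).map fun i => (f i, (i : ℕ)) := by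
  apply List.ext_getElem <;> simp

-- If the first argument agrees with another one, the majority value is again the first argument, so
-- only the test `x 1 = x 2` matters.
open Classical in
theorem dualDiscriminator_eq {D : Type*} (x : Fin 3 → D) :
    dualDiscriminator D x = if x 1 = x 2 then x 1 else x 0 := by
  unfold dualDiscriminator
  by_cases h : x 1 = x 2
  · by_cases h' : x 0 = x 2
    · rw [if_pos (.inr h'), if_pos h, h', h]
    · rw [if_neg (by rw [h]; tauto), if_pos h]
  · rw [if_neg h, ite_self]

theorem prod_update_mul {ι : Type*} [Fintype ι] [DecidableEq ι] (f g : ι → ℕ) (i : ι) :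
    (∏ j, if j = i then g j else f j) * f i = g i * ∏ j, f j := by
  rw [← Finset.mul_prod_erase Finset.univ f (Finset.mem_univ i),
    ← Finset.mul_prod_erase Finset.univ _ (Finset.mem_univ i), if_pos rfl,
    Finset.prod_congr rfl fun j hj => if_neg (Finset.ne_of_mem_erase hj)]
  ring

theorem costNum_eq (q : ℚ≥0) : (costNum q : ℚ≥0) = q * costDen q :=
  (NNRat.mul_den_eq_num q).symm

theorem costDen_pos (c : WithTop ℚ≥0) : 0 < costDen c := by
  cases c with
  | top => exact Nat.one_pos
  | coe q => exact q.den_pos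

/-! ### From costs to integer weights. -/

section
variable {n k : ℕ} (cost : Fin n → Fin k → WithTop ℚ≥0)

/-- The list of the entries of a table of costs. -/
def tableEntries : List ((ℕ × ℕ) × WithTop ℚ≥0) :=
  entries (List.ofFn fun v => List.ofFn (cost v))

theorem tableEntries_eq : tableEntries cost = (List.finRange n).flatMap fun v : Fin n =>
    (List.finRange k).map fun a : Fin k => (((v : ℕ), (a : ℕ)), cost v a) := by
  unfold tableEntries entries
  rw [zipIdx_ofFn, List.flatMap_map]
  congr 1
  funext v
  rw [zipIdx_ofFn, List.map_map]
  rfl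

theorem sum_map_tableEntries (F : (ℕ × ℕ) × WithTop ℚ≥0 → ℕ) :
    ((tableEntries cost).map F).sum = ∑ v : Fin n, ∑ a : Fin k, F ((v, a), cost v a) := by
  rw [tableEntries_eq, List.map_flatMap, List.flatMap, List.sum_flatten, List.map_map,
    Fin.sum_univ_def]
  congr 2
  funext v
  simp only [Function.comp_def, List.map_map, Fin.sum_univ_def]

theorem prod_map_tableEntries (F : (ℕ × ℕ) × WithTop ℚ≥0 → ℕ) :
    ((tableEntries cost).map F).prod = ∏ x : Fin n × Fin k, F ((x.1, x.2), cost x.1 x.2) := by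
  rw [tableEntries_eq, List.map_flatMap, List.flatMap, List.prod_flatten, List.map_map,
    Fintype.prod_prod_type, Fin.prod_univ_def]
  congr 2
  funext v
  simp only [Function.comp_def, List.map_map, Fin.prod_univ_def]

theorem commonDen_pos : 0 < commonDen (tableEntries cost) := by
  rw [commonDen, prod_map_tableEntries]
  exact Finset.prod_pos fun x _ => costDen_pos _

/-- The keys in the table are distinct, so `scaledCost` is the product of all denominators with
exactly one of them replaced by the numerator. -/
theorem scaledCost_mul (v : Fin n) (a : Fin k) :
    scaledCost (tableEntries cost) ((v, a), cost v a) * costDen (cost v a) =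
      costNum (cost v a) * commonDen (tableEntries cost) := by
  rw [commonDen, scaledCost, prod_map_tableEntries, prod_map_tableEntries]
  rw [← prod_update_mul (fun x : Fin n × Fin k => costDen (cost x.1 x.2))
    (fun x => costNum (cost x.1 x.2)) (v, a)]
  congr 1
  refine Finset.prod_congr rfl fun x _ => ?_
  have : ((x.1 : ℕ), (x.2 : ℕ)) = ((v : ℕ), (a : ℕ)) ↔ x = (v, a) := by
    simp [Prod.ext_iff, Fin.ext_iff]
  by_cases hx : x = (v, a)
  · simp [hx]
  · simp [hx, this]

theorem scaledCost_coe {v : Fin n} {a : Fin k} {q : ℚ≥0} (h : cost v a = q) :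
    (scaledCost (tableEntries cost) ((v, a), cost v a) : ℚ≥0) =
      q * commonDen (tableEntries cost) := by
  have h1 := scaledCost_mul cost v a
  have h2 : (costDen (q : WithTop ℚ≥0) : ℚ≥0) ≠ 0 := by
    exact_mod_cast (costDen_pos _).ne'
  rw [h] at h1 ⊢
  have h3 := congrArg (Nat.cast (R := ℚ≥0)) h1
  push_cast at h3
  rw [costNum_eq, mul_right_comm] at h3
  exact mul_right_cancel₀ h2 h3

open Classical in
/-- The integer weight of a label. -/
noncomputable def tableWeight (v : Fin n) (a : Fin k) : ℕ :=
  if cost v a = ⊤ then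
    k * (∑ v : Fin n, ∑ a : Fin k, scaledCost (tableEntries cost) ((v, a), cost v a)) + 1
  else scaledCost (tableEntries cost) ((v, a), cost v a)

theorem sumOn_weights {A : ℕ → ℕ} {A' : Fin n → Fin k} (hA : ∀ v : Fin n, A v = A' v) :
    sumOn (weights k (tableEntries cost)) (graphOf A) = ∑ v, tableWeight cost v (A' v) := by
  classical
  unfold sumOn weights
  rw [List.map_map, sum_map_tableEntries]
  refine Finset.sum_congr rfl fun v _ => ?_
  rw [Finset.sum_eq_single (A' v)]
  · have : ((v : ℕ), (A' v : ℕ)) ∈ graphOf A := hA v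
    simp [this, tableWeight, sum_map_tableEntries, Bool.cond_decide]
  · intro a _ ha
    have : ((v : ℕ), (a : ℕ)) ∉ graphOf A := by
      intro h
      have h' : A v = a := h
      rw [hA v] at h'
      exact ha (Fin.ext h'.symm)
    simp [this]
  · simp

/-- The approximation guarantee for the weights carries over to the costs. -/
theorem cost_le_of_tableWeight_le {A B : Fin n → Fin k}
    (h : ∑ v, tableWeight cost v (B v) ≤ k * ∑ v, tableWeight cost v (A v)) :
    ∑ v, cost v (B v) ≤ k • ∑ v, cost v (A v) := by
  classical
  by_cases hA : ∑ v, cost v (A v) = ⊤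
  · have hk : k ≠ 0 := by
      rintro rfl
      obtain ⟨v, -, -⟩ := WithTop.sum_eq_top.1 hA
      exact (A v).elim0
    obtain ⟨m, rfl⟩ := Nat.exists_eq_succ_of_ne_zero hk
    rw [hA, succ_nsmul, add_top]
    exact le_top
  have hA' : ∀ v, cost v (A v) ≠ ⊤ := fun v hv =>
    hA (WithTop.sum_eq_top.2 ⟨v, Finset.mem_univ v, hv⟩)
  have hwA : ∀ v, tableWeight cost v (A v) =
      scaledCost (tableEntries cost) ((v, A v), cost v (A v)) := fun v => by
    rw [tableWeight, if_neg (hA' v)]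
  -- A single infinite cost has a weight that exceeds `k` times the sum of all scaled finite costs,
  -- hence `k` times the weight of `A`.
  have hB' : ∀ v, cost v (B v) ≠ ⊤ := by
    intro v hv
    have h1 : tableWeight cost v (B v) ≤ ∑ v, tableWeight cost v (B v) :=
      Finset.single_le_sum (f := fun v => tableWeight cost v (B v)) (fun _ _ => Nat.zero_le _)
        (Finset.mem_univ v)
    have h2 : ∑ v, tableWeight cost v (A v) ≤
        ∑ v : Fin n, ∑ a : Fin k, scaledCost (tableEntries cost) ((v, a), cost v a) := by
      refine Finset.sum_le_sum fun v _ => ?_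
      rw [hwA]
      exact Finset.single_le_sum
        (f := fun a : Fin k => scaledCost (tableEntries cost) (((v : ℕ), (a : ℕ)), cost v a))
        (fun _ _ => Nat.zero_le _) (Finset.mem_univ (A v))
    have h3 := Nat.mul_le_mul_left k h2
    rw [tableWeight, if_pos hv] at h1
    omega
  have hwB : ∀ v, tableWeight cost v (B v) =
      scaledCost (tableEntries cost) ((v, B v), cost v (B v)) := fun v => by
    rw [tableWeight, if_neg (hB' v)]
  choose a ha using fun v => WithTop.ne_top_iff_exists.1 (hA' v)
  choose b hb using fun v => WithTop.ne_top_iff_exists.1 (hB' v)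
  have key : (∑ v, b v) * (commonDen (tableEntries cost) : ℚ≥0) ≤
      (k • ∑ v, a v) * (commonDen (tableEntries cost) : ℚ≥0) := by
    have h1 : ((∑ v, tableWeight cost v (B v) : ℕ) : ℚ≥0) ≤
        ((k * ∑ v, tableWeight cost v (A v) : ℕ) : ℚ≥0) := by exact_mod_cast h
    push_cast at h1
    simp only [hwA, hwB] at h1
    rw [Finset.sum_congr rfl fun v _ => scaledCost_coe cost (hb v).symm,
      Finset.sum_congr rfl fun v _ => scaledCost_coe cost (ha v).symm,
      ← Finset.sum_mul, ← Finset.sum_mul, ← mul_assoc] at h1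
    rwa [nsmul_eq_mul]
  have hN : (0 : ℚ≥0) < commonDen (tableEntries cost) := by exact_mod_cast commonDen_pos cost
  have h2 := le_of_mul_le_mul_right key hN
  simp only [← ha, ← hb]
  exact_mod_cast h2

end

/-! ### Instances as lists. -/

section
variable {D : Type*} [Fintype D] {Γ : Finset (Relation D)}
  (numD : D ≃ Fin (Fintype.card D)) (numΓ : {R // R ∈ Γ} ≃ Fin Γ.card)

open Classical in
/-- The list of the tuples of a relation. -/
noncomputable def Relation.tupleList (R : Relation D) : List (List ℕ) :=
  (Finset.univ.filter (· ∈ R.tuples)).toList.map fun t => List.ofFn fun j => (numD (t j) : ℕ)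

/-- The table of the relations of the constraint language. -/
noncomputable def relationTable : List (ℕ × List (List ℕ)) :=
  (List.finRange Γ.card).map fun i : Fin Γ.card => ((i : ℕ), (numΓ.symm i).1.tupleList numD)

namespace Instance

/-- The data of an instance. -/
def toLists (I : Instance Γ) : List (ℕ × List ℕ) × List (List (WithTop ℚ≥0)) :=
  (I.constraints.map fun C => ((numΓ C.rel : ℕ), List.ofFn fun j => (C.scope j : ℕ)),
    List.ofFn fun v => List.ofFn fun i => I.cost v (numD.symm i))

theorem enc_toLists (I : Instance Γ) : Enc.enc (I.toLists numD numΓ) = I.encode numD numΓ := by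
  simp only [toLists, encode, Enc.enc, List.map_map, List.map_ofFn, Function.comp_def]

/-- The constraints of an instance as lists of tuples. -/
noncomputable def tupleLists (I : Instance Γ) : List (List (List (ℕ × ℕ))) :=
  (I.toLists numD numΓ).1.map (constraintTuples (relationTable numD numΓ))

theorem mem_tupleLists {I : Instance Γ} {L : List (List (ℕ × ℕ))} :
    L ∈ I.tupleLists numD numΓ ↔ ∃ C ∈ I.constraints,
      (C.rel.1.tupleList numD).map (pairs (List.ofFn fun j => (C.scope j : ℕ))) = L := by
  have : ∀ C : Constraint Γ I.numVars,
      constraintTuples (relationTable numD numΓ) (numΓ C.rel, List.ofFn fun j => (C.scope j : ℕ)) =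
        (C.rel.1.tupleList numD).map (pairs (List.ofFn fun j => (C.scope j : ℕ))) := by
    intro C
    unfold constraintTuples relationTable
    rw [look_map Fin.val_injective _ (List.mem_finRange _)]
    simp
  simp only [tupleLists, toLists, List.map_map, List.mem_map, Function.comp, this]

theorem mem_map_pairs {R : Relation D} {scope : Fin R.arity → ℕ} {u : List (ℕ × ℕ)} :
    u ∈ (R.tupleList numD).map (pairs (List.ofFn scope)) ↔
      ∃ t ∈ R.tuples, pairs (List.ofFn scope) (List.ofFn fun j => (numD (t j) : ℕ)) = u := by
  simp [Relation.tupleList]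

theorem inRange_tupleLists (I : Instance Γ) :
    ∀ L ∈ I.tupleLists numD numΓ, InRange (List.range I.numVars) (Fintype.card D) L := by
  intro L hL u hu p hp
  obtain ⟨C, -, rfl⟩ := (mem_tupleLists numD numΓ).1 hL
  obtain ⟨t, -, rfl⟩ := (mem_map_pairs numD).1 hu
  obtain ⟨j, rfl⟩ := (mem_pairs_ofFn _ _ _).1 hp
  simp

theorem isDualDiscriminatorClosed_tupleLists
    (hΓ : IsPolymorphism Γ (dualDiscriminator D)) (I : Instance Γ) :
    ∀ L ∈ I.tupleLists numD numΓ, IsDualDiscriminatorClosed L := by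
  intro L hL
  obtain ⟨C, -, rfl⟩ := (mem_tupleLists numD numΓ).1 hL
  refine ⟨C.rel.1.arity, fun j => C.scope j,
    {t | ∃ t' ∈ C.rel.1.tuples, t = fun j => (numD (t' j) : ℕ)}, ?_, ?_, ?_⟩
  · rintro _ ⟨t, ht, rfl⟩
    exact ⟨_, (mem_map_pairs numD).2 ⟨t, ht, rfl⟩, mem_pairs_ofFn _ _⟩
  · intro u hu
    obtain ⟨t, ht, rfl⟩ := (mem_map_pairs numD).1 hu
    exact ⟨_, ⟨t, ht, rfl⟩, mem_pairs_ofFn _ _⟩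
  · rintro _ ⟨t, ht, rfl⟩ _ ⟨u, hu, rfl⟩ _ ⟨w, hw, rfl⟩
    have h := hΓ C.rel.1 C.rel.2 ![t, u, w] (by
      intro i
      fin_cases i <;> simpa)
    classical
    refine ⟨_, h, ?_⟩
    funext j
    rw [dualDiscriminator_eq]
    change _ = ((numD (if u j = w j then u j else t j) : Fin _) : ℕ)
    by_cases h1 : u j = w j
    · simp [h1]
    · simp [Fin.val_inj, h1]

theorem satAll_tupleLists_iff {I : Instance Γ} {A : Fin I.numVars → D} {B : ℕ → ℕ}
    (hB : ∀ v : Fin I.numVars, B v = numD (A v)) :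
    SatAll (I.tupleLists numD numΓ) B ↔ I.Satisfies A := by
  constructor
  · intro h C hC
    obtain ⟨u, hu, huB⟩ := h _ ((mem_tupleLists numD numΓ).2 ⟨C, hC, rfl⟩)
    obtain ⟨t, ht, rfl⟩ := (mem_map_pairs numD).1 hu
    have : (fun j => A (C.scope j)) = t := by
      funext j
      have h1 := huB _ ((mem_pairs_ofFn _ _ _).2 ⟨j, rfl⟩)
      rw [hB] at h1
      exact numD.injective (Fin.ext h1)
    rwa [this]
  · intro h L hL
    obtain ⟨C, hC, rfl⟩ := (mem_tupleLists numD numΓ).1 hL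
    refine ⟨_, (mem_map_pairs numD).2 ⟨_, h C hC, rfl⟩, fun p hp => ?_⟩
    obtain ⟨j, rfl⟩ := (mem_pairs_ofFn _ _ _).1 hp
    exact hB _

theorem totalCost_le_opt {I : Instance Γ} {k : ℕ} {B : Fin I.numVars → D} (hB : I.Satisfies B)
    (h : ∀ A, I.Satisfies A → I.totalCost B ≤ k • I.totalCost A) :
    I.totalCost B ≤ k • I.opt := by
  classical
  obtain ⟨A, hA, hA'⟩ := Finset.exists_mem_eq_inf
    (Finset.univ.filter fun A : Fin I.numVars → D => I.Satisfies A) ⟨B, by simpa using hB⟩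
    I.totalCost
  have h1 : I.opt = I.totalCost A := by
    rw [← hA', opt]
  rw [h1]
  exact h A (by simpa using hA)

theorem totalCost_eq (I : Instance Γ) (A : Fin I.numVars → D) :
    I.totalCost A = ∑ v, I.cost v (numD.symm (numD (A v))) := by
  simp [totalCost]

theorem solve_correct (hΓ : IsPolymorphism Γ (dualDiscriminator D)) (I : Instance Γ) :
    ∃ ans : Option (Fin I.numVars → D), I.IsApproxAnswer (Fintype.card D) ans ∧
      Enc.enc (solve (relationTable numD numΓ) (Fintype.card D) (I.toLists numD numΓ)) =
        encodeAnswer numD ans := by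
  let cost : Fin I.numVars → Fin (Fintype.card D) → WithTop ℚ≥0 := fun v i => I.cost v (numD.symm i)
  -- The variables are recovered from the number of rows of the cost table; this works even if there
  -- are no labels and all rows are empty.
  have hvars : (I.toLists numD numΓ).2.zipIdx.map Prod.snd = List.range I.numVars := by
    simp [toLists, List.range_eq_range']
  have hsolve : solve (relationTable numD numΓ) (Fintype.card D) (I.toLists numD numΓ) =
      answer (I.tupleLists numD numΓ) (List.range I.numVars) (assign (I.tupleLists numD numΓ)
        (List.range I.numVars) (List.range (Fintype.card D)) (weights (Fintype.card D) (tableEntries cost))) := by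
    unfold solve
    rw [hvars]
    rfl
  have hr := inRange_tupleLists numD numΓ I
  have hd := isDualDiscriminatorClosed_tupleLists numD numΓ hΓ I
  -- The abstract algorithm works with assignments on all of `ℕ`; the values outside the variables
  -- are irrelevant.
  have hext : ∀ A : Fin I.numVars → D, ∃ A' : ℕ → ℕ, (∀ v : Fin I.numVars, A' v = numD (A v)) ∧
      ∀ v ∈ List.range I.numVars, A' v < Fintype.card D := by
    intro A
    refine ⟨fun v => if h : v < I.numVars then numD (A ⟨v, h⟩) else 0, fun v => by simp,
      fun v hv => ?_⟩
    rw [List.mem_range] at hv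
    simp [hv]
  rw [hsolve]
  cases hans : answer (I.tupleLists numD numΓ) (List.range I.numVars)
      (assign (I.tupleLists numD numΓ) (List.range I.numVars) (List.range (Fintype.card D))
        (weights (Fintype.card D) (tableEntries cost))) with
  | none =>
    refine ⟨none, fun A hA => ?_, rfl⟩
    obtain ⟨A', h1, h2⟩ := hext A
    exact answer_assign_ne_none hr hd h2 ((satAll_tupleLists_iff numD numΓ h1).2 hA) hans
  | some l =>
    obtain ⟨B, hl, hB, hBsat, hBcost⟩ := answer_assign_eq_some hr hd hans
    let B' : Fin I.numVars → D := fun v => numD.symm ⟨B v, hB v (by simp)⟩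
    have hB' : ∀ v : Fin I.numVars, B v = numD (B' v) := fun v => by simp [B']
    have hBsat' := (satAll_tupleLists_iff numD numΓ hB').1 hBsat
    refine ⟨some B', ⟨hBsat', totalCost_le_opt hBsat' fun A hA => ?_⟩, ?_⟩
    · obtain ⟨A', h1, h2⟩ := hext A
      have h3 := hBcost A' h2 ((satAll_tupleLists_iff numD numΓ h1).2 hA) (by
        intro e he
        unfold weights at he
        rw [tableEntries_eq] at he
        simp only [List.mem_map, List.mem_flatMap] at he
        obtain ⟨_, ⟨v, -, a, -, rfl⟩, rfl⟩ := he
        simp)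
      rw [sumOn_weights cost h1, sumOn_weights cost hB'] at h3
      rw [totalCost_eq numD, totalCost_eq numD]
      exact cost_le_of_tableWeight_le cost h3
    · have : l = List.ofFn fun v => (numD (B' v) : ℕ) := by
        rw [hl]
        apply List.ext_getElem <;> simp [B']
      rw [this]
      simp only [encodeAnswer, Enc.enc, List.map_ofFn]
      rfl

end Instance
end

end CSP

theorem theorem1 {D : Type*} [Fintype D] (Γ : Finset (CSP.Relation D))
    (hΓ : CSP.IsPolymorphism Γ (CSP.dualDiscriminator D)) :
    CSP.PolyTimeApproximable Γ (Fintype.card D) := by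
  intro numD numΓ
  obtain ⟨p, b, h⟩ := CSP.pt_solve (CSP.relationTable numD numΓ) (Fintype.card D)
  refine ⟨p, b, fun I => ?_⟩
  obtain ⟨ans, h1, h2⟩ := I.solve_correct numD numΓ hΓ
  obtain ⟨t, h3, h4⟩ := h (I.toLists numD numΓ)
  rw [h2, CSP.Instance.enc_toLists] at h3
  rw [CSP.esize, CSP.Instance.enc_toLists] at h4
  exact ⟨ans, t, h3, h4, h1⟩
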